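/- **Definitions.** An *allowable sequence* on $m$ points is a doubly infinite sequence $\Pi=(\pi_i)_{i\in\mathbb Z}$ of permutations (words) of a set of $m$ points such that: (i) there is a positive integer $h=h(\Pi)$, the length of the halfperiod, such that $\pi_{i+h}$ is the reversal of $\pi_i$ for every $i\in\mathbb Z$; (ii) $\pi_i$ is obtained from $\pi_{i-1}$ by the reversal of one or more disjoint substrings, each consisting of at least two consecutive elements of $\pi_{i-1}$; these reversals are called *switches*, and they form the $i$-th *move*; (iii) any two distinct points participate together in exactly one switch within every $h$ consecutive moves. A *crossing switch* is a switch that reverses a centered substring. Such a sequence $\Pi$ is * *even-near-critical* if $m$ is even and $h(\Pi)=m$ (that is, $m$ is even and $h(\Pi)=2\lfloor m/2\rfloor$); * *centrally symmetric* if for every point $p$ there is a point $\overline p$ such that, in every $\pi_i$, the positions of $p$ and $\overline p$ add up to $m+1$; * in *noncentral general position* if every switch that is not a crossing switch involves exactly two points. For $m$ even, the *central signature* of $\Pi$ is the sequence $(d_1,\dots,d_t)$, where $2d_i$ is the number of points reversed by the $i$-th crossing switch in the halfperiod $\pi_0,\pi_1,\dots,\pi_h$. Two allowable sequences are *combinatorially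 equivalent* if they agree after a relabeling of the points and a shift of the indices. **Theorem.** Let $d=(d_1,\dots,d_t)$ with $t>1$ be a sequence of positive integers. Then there is an even-near-critical centrally symmetric allowable sequence $\Pi$ in noncentral general position whose central signature is $d$. Moreover, $\Pi$ is unique up to combinatorial equivalence: every even-near-critical centrally symmetric allowable sequence in noncentral general position, on any number of points, whose central signature is $d$ or a cyclic rotation of $d$ is combinatorially equivalent to $\Pi$. -/

import Mathlib

/-- A permutation of `m` points, written as a word: `π x` is the point in position `x`
(positions run from `0` to `m - 1`), so `π.symm p` is the position of the point `p`. -/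
abbrev PointOrder (m : ℕ) : Type := Equiv.Perm (Fin m)

/-- `IsMove S π π'`: the word `π'` is obtained from `π` by reversing one or more disjoint substrings.
A pair `(a, b) ∈ S` with `a < b` stands for the substring of `π` in positions `a, a + 1, …, b`. -/
structure IsMove {m : ℕ} (S : Finset (Fin m × Fin m)) (π π' : PointOrder m) : Prop where
  nonempty : S.Nonempty
  lt : ∀ s ∈ S, s.1 < s.2
  disjoint : ∀ s ∈ S, ∀ s' ∈ S, s ≠ s' → Disjoint (Finset.Icc s.1 s.2) (Finset.Icc s'.1 s'.2)
  reversed : ∀ s ∈ S, ∀ x y : Fin m, s.1 ≤ x → x ≤ s.2 →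
    (x : ℕ) + (y : ℕ) = (s.1 : ℕ) + (s.2 : ℕ) → π' x = π y
  unchanged : ∀ x : Fin m, (∀ s ∈ S, x ∉ Finset.Icc s.1 s.2) → π' x = π x

/-- An allowable sequence on `m` points: a doubly infinite sequence of words `perm i`, each obtained
from the preceding one by a move, such that `perm (i + halfLength)` is the reversal of `perm i` and
any two points participate together in exactly one switch within a halfperiod. The set `switches i`
is the `i`-th move, which leads from `perm (i - 1)` to `perm i`; it is determined by these two words. -/
structure AllowableSequence (m : ℕ) where
  perm : ℤ → PointOrder m
  switches : ℤ → Finset (Fin m × Fin m)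
  halfLength : ℕ
  halfLength_pos : 0 < halfLength
  reversal : ∀ (i : ℤ) (x : Fin m), perm (i + halfLength) x = perm i (Fin.rev x)
  isMove : ∀ i : ℤ, IsMove (switches i) (perm (i - 1)) (perm i)
  pair_once : ∀ (j : ℤ) (p q : Fin m), p ≠ q →
    ∃! i : ℤ, i ∈ Set.Ioc j (j + halfLength) ∧ ∃ s ∈ switches i,
      (perm (i - 1)).symm p ∈ Finset.Icc s.1 s.2 ∧ (perm (i - 1)).symm q ∈ Finset.Icc s.1 s.2

/-- The substring in positions `s.1, …, s.2` is centered. The switches reversing a centered substring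
are the crossing switches. -/
def IsCentered {m : ℕ} (s : Fin m × Fin m) : Prop := (s.1 : ℕ) + (s.2 : ℕ) + 1 = m

instance {m : ℕ} (s : Fin m × Fin m) : Decidable (IsCentered s) :=
  inferInstanceAs (Decidable ((s.1 : ℕ) + (s.2 : ℕ) + 1 = m))

namespace AllowableSequence

variable {m : ℕ}

/-- Every point `p` has a conjugate point `q`, in the mirror position in every word of the sequence. -/
def IsCentrallySymmetric (A : AllowableSequence m) : Prop :=
  ∀ p : Fin m, ∃ q : Fin m, ∀ i : ℤ,
    (((A.perm i).symm p : Fin m) : ℕ) + (((A.perm i).symm q : Fin m) : ℕ) + 1 = m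

/-- All switches, except perhaps for the crossing switches, are transpositions. -/
def IsInNoncentralGeneralPosition (A : AllowableSequence m) : Prop :=
  ∀ i : ℤ, ∀ s ∈ A.switches i, ¬ IsCentered s → (s.2 : ℕ) = (s.1 : ℕ) + 1

/-- The number `m` of points is even, and the halfperiods have the minimum length `2⌊m/2⌋`. -/
def IsEvenNearCritical (A : AllowableSequence m) : Prop :=
  Even m ∧ A.halfLength = 2 * (m / 2)

/-- Half of the number of points reversed by the crossing switch of the `i`-th move;
it is `0` if the `i`-th move has no crossing switch. (A move has at most one crossing switch.) -/
def crossingSize (A : AllowableSequence m) (i : ℤ) : ℕ :=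
  ∑ s ∈ (A.switches i).filter IsCentered, ((s.2 : ℕ) + 1 - (s.1 : ℕ)) / 2

/-- The central signature: the list of the halves of the numbers of points reversed by the crossing
switches in the moves `1, 2, …, h`, in this order, where `h` is the length of the halfperiod. -/
def centralSignature (A : AllowableSequence m) : List ℕ :=
  ((List.range A.halfLength).map fun k => A.crossingSize ((k : ℤ) + 1)).filter fun d => 0 < d

/-- Combinatorial equivalence: the two doubly infinite sequences of words agree
after a relabeling `e` of the points and a shift `k` of the indices. -/
def CombinatoriallyEquivalent {m' : ℕ} (A : AllowableSequence m) (A' : AllowableSequence m') : Prop :=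
  ∃ (e : Fin m ≃ Fin m') (k : ℤ), ∀ (i : ℤ) (x : Fin m) (y : Fin m'),
    (x : ℕ) = (y : ℕ) → A'.perm (i + k) y = e (A.perm i x)

end AllowableSequence

/-! With 2n points and halfperiod 2n, give each position an odd coordinate in (-2n, 2n), the center
being 0. Conjugate points have opposite coordinates. A move with a crossing switch of 2r points
negates the coordinates in (-2r, 2r) and displaces every other point by at most one position on its
own side.

Uniqueness is rigidity. After a crossing of 2d points, number those in the upper half 1, …, d from
the center. They keep their order for a halfperiod, so the j-th cannot move before the disturbance
has come in from outside: it waits d - j moves (`hold`), and by time reversal it waits as long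
before its next crossing. The innermost point has 2n - 2d + 1 moves left in which to trade places
with the 2n - 2d points outside the crossing, one per move, so it idles at most once. It cannot turn
without idling, since it would meet the same point twice. Hence it climbs, idles once and descends
(`innermost`). Order and speed squeeze the other points onto one path each (`eq_place`), so the
sequence is determined by the times and sizes of its crossings (`exists_eq`). Crossings of 2a and 2b
points are at least a + b moves apart (`gap`), and the half-sizes add up to n over a halfperiod
(`sum_radius`). Around the cycle all these inequalities are therefore equalities, and the signature
fixes the times up to a shift (`times_eq`).

For existence, cut the integers into consecutive blocks of lengths d_1, …, d_t, repeated with period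
n. The points are the integers modulo 2n, with c + n conjugate to c. The block [S, S + D) crosses at
time 2S + D, and each point follows the forced path. By linear arithmetic these paths are disjoint
and any two points change order exactly once per halfperiod (`existsUnique_flip`); `exists_of_coord`
turns the coordinates back into words and switches. -/

/-! ### Signed coordinates and their symmetries. -/

/-- How the signed coordinate of a point may change in a move that reverses the centered substring
`(-2r, 2r)` and otherwise displaces every point by at most one position. -/
def CentralStep (r a b : ℤ) : Prop :=
  (-(2 * r) < a ∧ a < 2 * r ∧ b = -a) ∨ (2 * r < a ∧ 2 * r < b ∧ b ≤ a + 2 ∧ a ≤ b + 2) ∨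
    (a < -(2 * r) ∧ b < -(2 * r) ∧ b ≤ a + 2 ∧ a ≤ b + 2)

theorem CentralStep.symm {r a b : ℤ} (h : CentralStep r a b) : CentralStep r b a := by
  unfold CentralStep at *; omega

theorem CentralStep.neg {r a b : ℤ} (h : CentralStep r a b) : CentralStep r (-a) (-b) := by
  unfold CentralStep at *; omega

/-- In a step, a point moving up by one position trades places with the point above it. -/
theorem CentralStep.swap_up {ι : Type*} {f g : ι → ℤ} {r N : ℤ} (hg : Function.Injective g)
    (hf : ∀ z : ℤ, z % 2 = 1 → -N < z → z < N → ∃ p, f p = z)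
    (hfo : ∀ p, f p % 2 = 1) (hgo : ∀ p, g p % 2 = 1) (hfl : ∀ p, -N < f p) (hgN : ∀ p, g p < N)
    (h : ∀ p, CentralStep r (f p) (g p)) (p q : ι) (hp : g p = f p + 2) (hq : f q = f p + 2) :
    g q = f p := by
  obtain ⟨k, hk⟩ : ∃ k : ℕ, N - f p ≤ k := ⟨(N - f p).toNat, Int.self_le_toNat _⟩
  induction k generalizing p q with
  | zero => have := hgN p; omega
  | succ k ih =>
    have hne : g q ≠ g p := fun e => by have := hg e; subst this; omega
    have h1 := h p
    have h2 := h q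
    have o1 := hfo q
    have o2 := hgo q
    -- If `q` moved up too, the point above it would by induction come down to the place that `p`
    -- takes.
    have : g q ≠ f q + 2 := by
      intro e
      have := hfl p
      obtain ⟨q', hq'⟩ := hf (f q + 2) (by omega) (by omega) (by have := hgN q; omega)
      have h3 := ih q q' e hq' (by omega)
      have : q' = p := hg (by omega)
      subst this; omega
    unfold CentralStep at h1 h2
    omega

/-- The order of the coordinates of `p` and `q` is reversed between `f` and `g`. -/
def Flips {ι : Type*} (f g : ι → ℤ) (p q : ι) : Prop :=
  (f p < f q ∧ g q < g p) ∨ (f q < f p ∧ g p < g q)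

/-- Signed coordinates of the points of an even-near-critical centrally symmetric allowable
sequence in noncentral general position; `r τ` is half the size of the `τ`-th crossing switch. -/
structure IsTrajectory {ι : Type*} (n : ℕ) (y : ℤ → ι → ℤ) (r : ℤ → ℕ) : Prop where
  injective : ∀ τ, Function.Injective (y τ)
  surjective : ∀ τ z, z % 2 = 1 → -(2 * n : ℤ) < z → z < 2 * n → ∃ p, y τ p = z
  odd : ∀ τ p, y τ p % 2 = 1
  lower : ∀ τ p, -(2 * n : ℤ) < y τ p
  upper : ∀ τ p, y τ p < 2 * n
  radius_le : ∀ τ, r τ ≤ n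
  antiperiodic : ∀ τ p, y (τ + 2 * n) p = -y τ p
  conj : ∀ p, ∃ q, ∀ τ, y τ q = -y τ p
  step : ∀ τ p, CentralStep (r τ) (y (τ - 1) p) (y τ p)
  once : ∀ (τ τ' : ℤ) (p q : ι), τ < τ' → τ' < τ + 2 * n → Flips (y (τ - 1)) (y τ) p q →
    ¬ Flips (y (τ' - 1)) (y τ') p q

namespace IsTrajectory

variable {ι : Type*} {n : ℕ} {y : ℤ → ι → ℤ} {r : ℤ → ℕ}

theorem swap_up (h : IsTrajectory n y r) {τ : ℤ} {p q : ι} (hp : y τ p = y (τ - 1) p + 2)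
    (hq : y (τ - 1) q = y (τ - 1) p + 2) : y τ q = y (τ - 1) p :=
  CentralStep.swap_up (r := r τ) (N := 2 * n) (h.injective τ) (h.surjective _) (h.odd _) (h.odd _)
    (h.lower _) (h.upper _) (h.step τ) p q hp hq

theorem shift (h : IsTrajectory n y r) (k : ℤ) :
    IsTrajectory n (fun τ => y (τ + k)) (fun τ => r (τ + k)) where
  injective τ := h.injective _
  surjective τ := h.surjective _
  odd τ := h.odd _
  lower τ := h.lower _
  upper τ := h.upper _
  radius_le τ := h.radius_le _
  antiperiodic τ p := by rw [← h.antiperiodic, add_right_comm]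
  conj p := (h.conj p).imp fun q hq τ => hq _
  step τ p := by have := h.step (τ + k) p; rwa [show τ - 1 + k = τ + k - 1 by ring]
  once τ τ' p q h1 h2 := by
    rw [show τ - 1 + k = τ + k - 1 by ring, show τ' - 1 + k = τ' + k - 1 by ring]
    exact h.once _ _ _ _ (by omega) (by omega)

/-- The `τ`-th move of the reversed sequence undoes the move `1 - τ`, whence the index of the
radius. -/
theorem reverse (h : IsTrajectory n y r) :
    IsTrajectory n (fun τ => y (-τ)) (fun τ => r (1 - τ)) where
  injective τ := h.injective _
  surjective τ := h.surjective _
  odd τ := h.odd _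
  lower τ := h.lower _
  upper τ := h.upper _
  radius_le τ := h.radius_le _
  antiperiodic τ p := by
    have := h.antiperiodic (-(τ + 2 * n)) p
    rw [show -(τ + 2 * (n : ℤ)) + 2 * n = -τ by ring] at this
    simp only [this, neg_neg]
  conj p := (h.conj p).imp fun q hq τ => hq _
  step τ p := by
    have := (h.step (1 - τ) p).symm
    rwa [show 1 - τ - 1 = -τ by ring, show y (1 - τ) p = y (-(τ - 1)) p by congr 1; ring] at this
  once τ τ' p q h1 h2 f1 f2 := by
    refine h.once (1 - τ') (1 - τ) p q (by omega) (by omega) ?_ ?_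
    · rw [show 1 - τ' - 1 = -τ' by ring, show 1 - τ' = -(τ' - 1) by ring]
      unfold Flips at *; omega
    · rw [show 1 - τ - 1 = -τ by ring, show 1 - τ = -(τ - 1) by ring]
      unfold Flips at *; omega

theorem neg (h : IsTrajectory n y r) : IsTrajectory n (fun τ p => -y τ p) r where
  injective τ p q e := h.injective τ (by simpa using e)
  surjective τ z h1 h2 h3 := by
    obtain ⟨p, hp⟩ := h.surjective τ (-z) (by omega) (by omega) (by omega)
    exact ⟨p, by simp [hp]⟩
  odd τ p := by have := h.odd τ p; omega
  lower τ p := by have := h.upper τ p; omega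
  upper τ p := by have := h.lower τ p; omega
  radius_le τ := h.radius_le _
  antiperiodic τ p := by rw [h.antiperiodic]
  conj p := (h.conj p).imp fun q hq τ => by rw [hq]
  step τ p := (h.step τ p).neg
  once τ τ' p q h1 h2 f1 f2 := by
    refine h.once τ τ' p q h1 h2 ?_ ?_ <;> simp only [Flips, neg_lt_neg_iff] at * <;> omega

theorem swap_down (h : IsTrajectory n y r) {τ : ℤ} {p q : ι} (hp : y τ p = y (τ - 1) p - 2)
    (hq : y (τ - 1) q = y (τ - 1) p - 2) : y τ q = y (τ - 1) p := by
  have := h.neg.swap_up (τ := τ) (p := p) (q := q) (by omega) (by omega)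
  simpa using this

/-! ### Points between two crossing switches. -/

/-- A point changes sides at most once within a halfperiod. -/
theorem pos_of_pos_of_lt (h : IsTrajectory n y r) {T : ℤ} {p : ι} (h0 : y (T - 1) p < 0)
    (h1 : 0 < y T p) {s : ℕ} (hs : s < 2 * n) : 0 < y (T + s) p := by
  induction s with
  | zero => simpa using h1
  | succ s ih =>
    have h2 := ih (by omega)
    by_contra hc
    -- A point that changes sides changes order with its conjugate, which is allowed only once.
    obtain ⟨q, hq⟩ := h.conj p
    have := h.odd (T + (s + 1 : ℕ)) p
    refine h.once T (T + (s + 1 : ℕ)) p q (by omega) (by omega) ?_ ?_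
    · left; simp only [hq]; omega
    · right
      rw [show T + ((s + 1 : ℕ) : ℤ) - 1 = T + s by push_cast; ring]
      simp only [hq]; omega

/-- The points of a crossing switch keep their order during the following halfperiod. -/
theorem order (h : IsTrajectory n y r) {T : ℤ} {p q : ι} (h0 : y (T - 1) q < y (T - 1) p)
    (h1 : y T p < y T q) {s : ℕ} (hs : s < 2 * n) : y (T + s) p < y (T + s) q := by
  induction s with
  | zero => simpa using h1
  | succ s ih =>
    have h2 := ih (by omega)
    by_contra hc
    have : y (T + (s + 1 : ℕ)) p ≠ y (T + (s + 1 : ℕ)) q := fun e => by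
      have := h.injective _ e; subst this; omega
    refine h.once T (T + (s + 1 : ℕ)) p q (by omega) (by omega) ?_ ?_
    · right; omega
    · left
      rw [show T + ((s + 1 : ℕ) : ℤ) - 1 = T + s by push_cast; ring]
      omega

theorem before_cross (h : IsTrajectory n y r) {T : ℤ} {p : ι} (h1 : y T p < 2 * r T)
    (h2 : -(2 * r T : ℤ) < y T p) : y (T - 1) p = -y T p := by
  have := h.step T p
  unfold CentralStep at this; omega

section Crossing

variable {T : ℤ} {p q : ι} {s : ℕ}

theorem cross_pos (h : IsTrajectory n y r) (h1 : y T p < 2 * r T) (h2 : 0 < y T p)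
    (hs : s < 2 * n) : 0 < y (T + s) p :=
  h.pos_of_pos_of_lt (by rw [h.before_cross h1 (by omega)]; omega) h2 hs

theorem cross_order (h : IsTrajectory n y r) (h1 : y T q < 2 * r T) (h2 : 0 < y T p)
    (h3 : y T p < y T q) (hs : s < 2 * n) : y (T + s) p < y (T + s) q :=
  h.order (by rw [h.before_cross h1 (by omega), h.before_cross (by omega) (by omega)]; omega) h3 hs

/-- Between two crossings, a point of the upper half does not take part in crossing switches. -/
theorem cross_step (h : IsTrajectory n y r) (h1 : y T p < 2 * r T) (h2 : 0 < y T p)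
    (hs : s + 1 < 2 * n) : 2 * (r (T + s + 1) : ℤ) < y (T + s) p ∧
      2 * (r (T + s + 1) : ℤ) < y (T + s + 1) p ∧ y (T + s + 1) p ≤ y (T + s) p + 2 ∧
      y (T + s) p ≤ y (T + s + 1) p + 2 := by
  have a := h.cross_pos h1 h2 (s := s) (by omega)
  have b := h.cross_pos h1 h2 hs
  have c := h.step (T + s + 1) p
  rw [show T + ((s + 1 : ℕ) : ℤ) = T + s + 1 by push_cast; ring] at b
  rw [show T + (s : ℤ) + 1 - 1 = T + s by ring] at c
  unfold CentralStep at c; omega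

/-- If one point entered the place just held by the other, the two would trade places and their
order would change before the next crossing. Comparing positions one move apart in this way is what
forces the waiting in `hold` and the induction in `eq_place`. -/
theorem cross_no_swap (h : IsTrajectory n y r) (h1 : y T q < 2 * r T) (h2 : 0 < y T p)
    (h3 : y T p < y T q) (hs : s + 1 < 2 * n) : y (T + s + 1) p + 2 ≤ y (T + s) q ∧
      y (T + s) p + 2 ≤ y (T + s + 1) q := by
  have a := h.cross_order h1 h2 h3 (s := s) (by omega)
  have b := h.cross_order h1 h2 h3 hs
  rw [show T + ((s + 1 : ℕ) : ℤ) = T + s + 1 by push_cast; ring] at b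
  have c := h.cross_step (by omega : y T p < 2 * r T) h2 hs
  have d := h.cross_step h1 (by omega) hs
  have e1 := h.odd (T + s) p
  have e2 := h.odd (T + s) q
  have e3 := h.odd (T + s + 1) p
  have e4 := h.odd (T + s + 1) q
  have su := h.swap_up (τ := T + s + 1) (p := p) (q := q)
  have sd := h.swap_down (τ := T + s + 1) (p := q) (q := p)
  rw [show T + (s : ℤ) + 1 - 1 = T + s by ring] at su sd
  omega

/-- The points of a crossing switch stay in place until the disturbance from outside arrives. -/
theorem hold (h : IsTrajectory n y r) {j : ℕ} (hp : y T p = 2 * j - 1) (hj : 1 ≤ j)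
    (hs : j + s ≤ r T) : y (T + s) p = 2 * j - 1 := by
  have hr := h.radius_le T
  induction s generalizing j p with
  | zero => simpa using hp
  | succ s ih =>
    have hp1 := ih hp hj (by omega)
    -- The next point outward has not moved yet and blocks the way up. The way down is blocked by
    -- the next point inward or, for `j = 1`, by the center.
    obtain ⟨q, hq⟩ := h.surjective T (2 * j + 1) (by omega) (by omega) (by omega)
    have hq1 := ih (j := j + 1) (p := q) (by push_cast; omega) (by omega) (by omega)
    have c := h.cross_step (p := p) (s := s) (T := T) (by omega) (by omega) (by omega)
    have d := h.cross_no_swap (p := p) (q := q) (s := s) (T := T) (by omega) (by omega) (by omega)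
      (by omega)
    have e := h.odd (T + s + 1) p
    rw [show T + ((s + 1 : ℕ) : ℤ) = T + s + 1 by push_cast; ring]
    have : y (T + s + 1) p ≠ 2 * j - 3 := by
      intro e'
      by_cases hj1 : j = 1
      · subst hj1; omega
      obtain ⟨q, hq⟩ := h.surjective T (2 * j - 3) (by omega) (by omega) (by omega)
      have hq1 := ih (j := j - 1) (p := q) (by omega) (by omega) (by omega)
      have d := h.cross_no_swap (p := q) (q := p) (s := s) (T := T) (by omega) (by omega)
        (by omega) (by omega)
      omega
    push_cast at hq1
    omega

/-- By antiperiodicity the two moves are mirror images. If the radii differed, a point just outside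
the smaller centered substring would change sides in one move and not in the other. -/
theorem radius_periodic (h : IsTrajectory n y r) (τ : ℤ) : r (τ + 2 * n) = r τ := by
  have key : ∀ p, y (τ + 2 * n - 1) p = -y (τ - 1) p := fun p => by
    rw [← h.antiperiodic]; congr 1; ring
  have h1 := h.radius_le τ
  have h2 := h.radius_le (τ + 2 * n)
  rcases lt_trichotomy (r (τ + 2 * n)) (r τ) with hlt | heq | hlt
  · obtain ⟨p, hp⟩ := h.surjective (τ - 1) (2 * r (τ + 2 * n) + 1) (by omega) (by omega) (by omega)
    have a := h.step τ p
    have b := h.step (τ + 2 * n) p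
    rw [key, h.antiperiodic] at b
    unfold CentralStep at a b; omega
  · exact heq
  · obtain ⟨p, hp⟩ := h.surjective (τ - 1) (2 * r τ + 1) (by omega) (by omega) (by omega)
    have a := h.step τ p
    have b := h.step (τ + 2 * n) p
    rw [key, h.antiperiodic] at b
    unfold CentralStep at a b; omega

theorem cross_end (h : IsTrajectory n y r) (h1 : y T p < 2 * r T) (h2 : 0 < y T p) :
    y (T + 2 * n - 1) p = y T p := by
  have := h.before_cross h1 (by omega)
  rw [show T + 2 * (n : ℤ) - 1 = T - 1 + 2 * n by ring, h.antiperiodic, this, neg_neg]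

/-- This is `hold` read backward from the next crossing of the same points. -/
theorem hold_end (h : IsTrajectory n y r) {j : ℕ} (hp : y T p = 2 * j - 1) (hj : 1 ≤ j)
    (hs : j + s ≤ r T) : y (T + 2 * n - 1 - s) p = 2 * j - 1 := by
  have := h.reverse.hold (T := 1 - (T + 2 * n)) (p := p) (s := s) (j := j) (by
    rw [show -(1 - (T + 2 * (n : ℤ))) = T + 2 * n - 1 by ring,
      h.cross_end (by omega) (by omega), hp]) hj (by
    rw [show 1 - (1 - (T + 2 * (n : ℤ))) = T + 2 * n by ring, h.radius_periodic]; exact hs)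
  rwa [show -(1 - (T + 2 * (n : ℤ)) + s) = T + 2 * n - 1 - s by ring] at this

theorem cross_speed (h : IsTrajectory n y r) (h1 : y T p < 2 * r T) (h2 : 0 < y T p) {k : ℕ}
    (hs : s + k < 2 * n) : y (T + s + k) p ≤ y (T + s) p + 2 * k ∧
      y (T + s) p ≤ y (T + s + k) p + 2 * k := by
  induction k with
  | zero => simp
  | succ k ih =>
    have := ih (by omega)
    have c := h.cross_step h1 h2 (s := s + k) (by omega)
    push_cast at c ⊢
    rw [show T + ((s : ℤ) + k) = T + s + k by ring] at c
    rw [← add_assoc]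
    omega

/-- Crossing switches of sizes `2 * a` and `2 * b` are at least `a + b` moves apart. -/
theorem gap (h : IsTrajectory n y r) {T' : ℤ} (hT : T < T') (hT' : T' < T + 2 * n) (h0 : 0 < r T)
    (h0' : 0 < r T') : (r T : ℤ) + r T' ≤ T' - T := by
  have hr := h.radius_le T
  -- The innermost point waits `r T - 1` moves, then climbs at most one place per move, and must be
  -- beyond place `r T'` just before the move `T'`.
  obtain ⟨p, hp⟩ := h.surjective T 1 (by omega) (by omega) (by omega)
  obtain ⟨k, hk⟩ : ∃ k : ℕ, T' = T + k + 1 := ⟨(T' - T - 1).toNat, by omega⟩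
  have hst := h.cross_step (T := T) (p := p) (s := k) (by omega) (by omega) (by omega)
  rw [← hk] at hst
  rcases le_total (1 + k) (r T) with hle | hle
  · have := h.hold (T := T) (p := p) (j := 1) (s := k) (by push_cast; omega) le_rfl hle
    omega
  · have h3 := h.hold (T := T) (p := p) (j := 1) (s := r T - 1) (by push_cast; omega) le_rfl
      (by omega)
    have h4 := h.cross_speed (T := T) (p := p) (s := r T - 1) (k := k - (r T - 1)) (by omega)
      (by omega) (by omega)
    rw [show T + ((r T - 1 : ℕ) : ℤ) + (k - (r T - 1) : ℕ) = T + k by omega] at h4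
    omega

end Crossing

end IsTrajectory

/-! ### The forced path of a point between its crossings. -/

/-- A nonnegative walk of length `2N + 1` that returns to its start, idles at most once and never
turns without idling goes up `N` times, idles, and goes down `N` times. -/
theorem tent_of_walk {N : ℕ} {u : ℕ → ℤ} (h0 : u 0 = 0) (h1 : u (2 * N + 1) = 0)
    (hpos : ∀ k ≤ 2 * N + 1, 0 ≤ u k)
    (hstep : ∀ k < 2 * N + 1, u (k + 1) ≤ u k + 1 ∧ u k ≤ u (k + 1) + 1)
    (hturn : ∀ k, k + 1 < 2 * N + 1 → u (k + 2) = u k → u (k + 1) = u k)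
    (hidle : ∀ k l, k < l → l < 2 * N + 1 → u (k + 1) = u k → u (l + 1) ≠ u l) {k : ℕ}
    (hk : k ≤ 2 * N + 1) : u k = min (k : ℤ) (2 * N + 1 - k) := by
  have up : ∀ K ≤ 2 * N + 1, (∀ k < K, u (k + 1) ≠ u k) → ∀ k ≤ K, u k = k := by
    intro K hK hne k
    induction k using Nat.strong_induction_on with
    | _ k ih =>
      intro hk
      match k with
      | 0 => simpa using h0
      | 1 =>
        have a := hstep 0 (by omega)
        have b := hne 0 (by omega)
        have c := hpos 1 (by omega)
        simp only [zero_add] at a b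
        push_cast; omega
      | k + 2 =>
        have a := ih k (by omega) (by omega)
        have b := ih (k + 1) (by omega) (by omega)
        have c := hstep (k + 1) (by omega)
        have d := hne (k + 1) (by omega)
        have e := hturn k (by omega)
        simp only [show k + 1 + 1 = k + 2 from rfl] at c d
        push_cast at *
        omega
  have down : ∀ K ≤ 2 * N + 1, (∀ k, K ≤ k → k < 2 * N + 1 → u (k + 1) ≠ u k) →
      ∀ l k, K ≤ k → k + l = 2 * N + 1 → u k = l := by
    intro K hK hne l
    induction l using Nat.strong_induction_on with
    | _ l ih =>
      intro k hk hkl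
      match l with
      | 0 => rw [show k = 2 * N + 1 by omega]; simpa using h1
      | 1 =>
        obtain rfl : k = 2 * N := by omega
        have a := hstep (2 * N) (by omega)
        have b := hne (2 * N) (by omega) (by omega)
        have c := hpos (2 * N) (by omega)
        push_cast; omega
      | l + 2 =>
        have a := ih l (by omega) (k + 2) (by omega) (by omega)
        have b := ih (l + 1) (by omega) (k + 1) (by omega) (by omega)
        have c := hstep k (by omega)
        have d := hne k (by omega) (by omega)
        have e := hturn k (by omega)
        push_cast at *
        omega
  by_cases hex : ∃ z < 2 * N + 1, u (z + 1) = u z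
  · obtain ⟨z, hz, e⟩ := hex
    -- The idle step separates the ascent from the descent; equating `u z = z` with `u (z + 1) = 2 *
    -- N - z` puts it at `z = N`.
    have a := up z (by omega) (fun k hk e' => hidle k z hk hz e' e)
    have b := down (z + 1) (by omega) (fun k hk hk' => hidle z k (by omega) hk' e)
    have c := a z le_rfl
    have d := b (2 * N + 1 - (z + 1)) (z + 1) le_rfl (by omega)
    rcases le_or_gt k z with hkz | hkz
    · have := a k hkz; omega
    · have := b (2 * N + 1 - k) k (by omega) (by omega); omega
  -- Without an idle step the walk would climb all the way and not return to `0`.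
  · push Not at hex
    have := up (2 * N + 1) le_rfl (fun k hk => hex k (by omega)) (2 * N + 1) le_rfl
    push_cast at this; omega

/-- The place (counted from the center) of the `j`-th point of a crossing switch of `2 * d` points,
`s` moves after this switch. -/
def place (n d j s : ℤ) : ℤ := max j (min (n - d + j) (min (2 * j - d + s) (2 * j - d + 2 * n - 1 - s)))

namespace IsTrajectory

variable {ι : Type*} {n : ℕ} {y : ℤ → ι → ℤ} {r : ℤ → ℕ}

/-- After a halfperiod all coordinates are negated, so the order has changed somewhere on the way.
-/
theorem exists_flip (h : IsTrajectory n y r) {p q : ι} (hpq : p ≠ q) (T : ℤ) :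
    ∃ s : ℕ, s < 2 * n ∧ Flips (y (T + s)) (y (T + s + 1)) p q := by
  by_contra! hc
  have hne : ∀ τ, y τ p ≠ y τ q := fun τ e => hpq (h.injective τ e)
  have : ∀ s : ℕ, s ≤ 2 * n → (y (T + s) p < y (T + s) q ↔ y T p < y T q) := by
    intro s
    induction s with
    | zero => simp
    | succ s ih =>
      intro hs
      rw [← ih (by omega)]
      have a := hc s (by omega)
      have b := hne (T + s)
      have c := hne (T + s + 1)
      unfold Flips at a
      push_cast
      rw [← add_assoc]
      omega
  have a := this (2 * n) le_rfl
  push_cast at a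
  rw [h.antiperiodic, h.antiperiodic] at a
  have := hne T
  omega

theorem flip_off_center (h : IsTrajectory n y r) {τ : ℤ} {p q : ι} (h1 : 2 * (r (τ + 1) : ℤ) < y τ p)
    (h2 : 2 * (r (τ + 1) : ℤ) < y (τ + 1) p) (hf : Flips (y τ) (y (τ + 1)) p q) :
    y τ q = y (τ + 1) p ∧ y (τ + 1) q = y τ p ∧ y (τ + 1) p ≠ y τ p := by
  have a := h.step (τ + 1) p
  have b := h.step (τ + 1) q
  rw [show τ + 1 - 1 = τ by ring] at a b
  have e1 := h.odd τ p
  have e2 := h.odd τ q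
  have e3 := h.odd (τ + 1) p
  have e4 := h.odd (τ + 1) q
  unfold CentralStep at a b
  unfold Flips at hf
  omega

theorem card_cross (h : IsTrajectory n y r) [Fintype ι] (τ : ℤ) :
    (Finset.univ.filter fun p => -(2 * r τ : ℤ) < y τ p ∧ y τ p < 2 * r τ).card = 2 * r τ := by
  have hr := h.radius_le τ
  rw [← Finset.card_image_of_injective _ (h.injective τ)]
  have : Finset.image (y τ) (Finset.univ.filter fun p => -(2 * r τ : ℤ) < y τ p ∧ y τ p < 2 * r τ) =
      (Finset.Ico (-(r τ : ℤ)) (r τ)).image fun k => 2 * k + 1 := by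
    ext z
    simp only [Finset.mem_image, Finset.mem_filter, Finset.mem_univ, true_and, Finset.mem_Ico]
    constructor
    · rintro ⟨p, hp, rfl⟩
      exact ⟨y τ p / 2, by have := h.odd τ p; omega, by have := h.odd τ p; omega⟩
    · rintro ⟨k, hk, rfl⟩
      obtain ⟨p, hp⟩ := h.surjective τ (2 * k + 1) (by omega) (by omega) (by omega)
      exact ⟨p, by omega, hp⟩
  rw [this, Finset.card_image_of_injective _ (fun a b e => by omega), Int.card_Ico]
  omega

theorem card_points (h : IsTrajectory n y r) [Fintype ι] : Fintype.card ι = 2 * n := by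
  have : Finset.image (y 0) Finset.univ = (Finset.Ico (-(n : ℤ)) n).image fun k => 2 * k + 1 := by
    ext z
    simp only [Finset.mem_image, Finset.mem_univ, true_and, Finset.mem_Ico]
    constructor
    · rintro ⟨p, rfl⟩
      have a := h.odd 0 p
      have b := h.lower 0 p
      have c := h.upper 0 p
      exact ⟨y 0 p / 2, by omega, by omega⟩
    · rintro ⟨k, hk, rfl⟩
      exact h.surjective 0 (2 * k + 1) (by omega) (by omega) (by omega)
  rw [← Finset.card_univ, ← Finset.card_image_of_injective _ (h.injective 0), this,
    Finset.card_image_of_injective _ (fun a b e => by omega), Int.card_Ico]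
  omega

/-- The innermost point of a crossing switch idles at most once on its way. -/
theorem innermost_idle (h : IsTrajectory n y r) [Fintype ι] {T : ℤ} {p : ι} (h0 : 0 < r T)
    (hp : y T p = 1) {k l : ℕ} (hk : r T ≤ k + 1) (hkl : k < l) (hl : l + r T < 2 * n)
    (ek : y (T + k + 1) p = y (T + k) p) : y (T + l + 1) p ≠ y (T + l) p := by
  intro el
  have hr := h.radius_le T
  classical
  -- `p` must change order with each of the `2 * n - 2 * r T` points outside `C`. Waiting excludes
  -- the first `r T - 1` moves; waiting and the next crossing exclude the last `r T`. Of the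
  -- remaining `2 * n - 2 * r T + 1` moves, two idle ones would leave too few.
  set C := Finset.univ.filter fun p => -(2 * r T : ℤ) < y T p ∧ y T p < 2 * r T with hC
  have hQ : (Cᶜ).card = 2 * n - 2 * r T := by
    rw [Finset.card_compl, h.card_points, h.card_cross]
  have hpC : ∀ q ∈ Cᶜ, p ≠ q := by
    rintro q hq rfl
    simp only [hC, Finset.mem_compl, Finset.mem_filter, Finset.mem_univ, true_and] at hq
    omega
  have hstep : ∀ s : ℕ, s + 1 < 2 * n → _ := fun s hs =>
    h.cross_step (p := p) (T := T) (s := s) (by omega) (by omega) hs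
  choose! φ hφ hφ' using fun q (hq : q ∈ Cᶜ) => h.exists_flip (hpC q hq) T
  have hmove : ∀ q ∈ Cᶜ, φ q + 1 < 2 * n ∧ y (T + φ q + 1) p ≠ y (T + φ q) p := by
    intro q hq
    have hφn := hφ q hq
    have hf := hφ' q hq
    -- The move `T + 2 * n` is the next crossing of `p`; a point outside `C` stays on its side of
    -- the reversed substring.
    have hlt : φ q + 1 < 2 * n := by
      by_contra hcon
      have e1 : T + φ q + 1 = T + 2 * n := by omega
      have e2 : T + (φ q : ℤ) = T + 2 * n - 1 := by omega
      rw [e1, e2] at hf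
      have a := h.step (T + 2 * n) q
      have b := h.cross_end (T := T) (p := p) (by omega) (by omega)
      rw [Flips, b, h.antiperiodic, h.antiperiodic] at hf
      rw [h.radius_periodic, h.antiperiodic] at a
      simp only [hC, Finset.mem_compl, Finset.mem_filter, Finset.mem_univ, true_and] at hq
      unfold CentralStep at a
      omega
    have c := hstep _ hlt
    exact ⟨hlt, (h.flip_off_center c.1 c.2.1 hf).2.2⟩
  have hrange : ∀ q ∈ Cᶜ, φ q ∈ ((Finset.Ico (r T - 1) (2 * n - r T)).erase k).erase l := by
    intro q hq
    obtain ⟨a, b⟩ := hmove q hq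
    simp only [Finset.mem_erase, Finset.mem_Ico]
    refine ⟨fun e => b (e ▸ el), fun e => b (e ▸ ek), ?_, ?_⟩
    · by_contra hcon
      have c := h.hold (T := T) (p := p) (j := 1) (s := φ q) (by push_cast; omega) le_rfl (by omega)
      have d := h.hold (T := T) (p := p) (j := 1) (s := φ q + 1) (by push_cast; omega) le_rfl
        (by omega)
      apply b
      push_cast at d
      rw [← add_assoc] at d
      omega
    · by_contra hcon
      have c := h.hold_end (T := T) (p := p) (j := 1) (s := 2 * n - 1 - φ q) (by push_cast; omega)
        le_rfl (by omega)
      have d := h.hold_end (T := T) (p := p) (j := 1) (s := 2 * n - 1 - (φ q + 1))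
        (by push_cast; omega) le_rfl (by omega)
      rw [show T + 2 * (n : ℤ) - 1 - (2 * n - 1 - φ q : ℕ) = T + φ q by omega] at c
      rw [show T + 2 * (n : ℤ) - 1 - (2 * n - 1 - (φ q + 1) : ℕ) = T + φ q + 1 by omega] at d
      exact b (by omega)
  have hinj : Set.InjOn φ (Cᶜ : Finset ι) := by
    intro q hq q' hq' e
    have c := hstep _ (hmove q hq).1
    have a := h.flip_off_center c.1 c.2.1 (hφ' q hq)
    have b := h.flip_off_center c.1 c.2.1 (q := q') (by rw [e]; exact hφ' q' hq')
    exact h.injective _ (a.1.trans b.1.symm)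
  have hcard := Finset.card_le_card_of_injOn φ hrange hinj
  rw [Finset.card_erase_of_mem (by simp only [Finset.mem_erase, Finset.mem_Ico]; omega),
    Finset.card_erase_of_mem (by simp only [Finset.mem_Ico]; omega), Nat.card_Ico, hQ] at hcard
  omega

/-- A displacement undone by the following move would be two trades with the same point. -/
theorem innermost_turn (h : IsTrajectory n y r) {T : ℤ} {p : ι} (h0 : 0 < r T)
    (hp : y T p = 1) {k : ℕ} (hk : k + 2 < 2 * n) (e : y (T + k + 2) p = y (T + k) p) :
    y (T + k + 1) p = y (T + k) p := by
  by_contra hne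
  have a := h.cross_step (p := p) (T := T) (s := k) (by omega) (by omega) (by omega)
  have b := h.cross_step (p := p) (T := T) (s := k + 1) (by omega) (by omega) (by omega)
  push_cast at b
  rw [← add_assoc, show T + (k : ℤ) + 1 + 1 = T + k + 2 by ring] at b
  have o1 := h.odd (T + k) p
  have o2 := h.odd (T + k + 1) p
  have u1 := h.upper (T + k + 1) p
  obtain ⟨q, hq⟩ := h.surjective (T + k) (y (T + k + 1) p) o2 (by omega) (by omega)
  have su := h.swap_up (τ := T + k + 1) (p := p) (q := q)
  have sd := h.swap_down (τ := T + k + 1) (p := p) (q := q)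
  have su' := h.swap_up (τ := T + k + 2) (p := p) (q := q)
  have sd' := h.swap_down (τ := T + k + 2) (p := p) (q := q)
  rw [show T + (k : ℤ) + 1 - 1 = T + k by ring] at su sd
  rw [show T + (k : ℤ) + 2 - 1 = T + k + 1 by ring] at su' sd'
  apply h.once (T + k + 1) (T + k + 2) p q (by omega) (by omega) <;>
    first
    | rw [show T + (k : ℤ) + 1 - 1 = T + k by ring]
    | rw [show T + (k : ℤ) + 2 - 1 = T + k + 1 by ring]
  all_goals
    obtain hd | hd : y (T + k + 1) p = y (T + k) p + 2 ∨ y (T + k + 1) p = y (T + k) p - 2 := by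
      omega
  · have := su hd (by omega); unfold Flips; omega
  · have := sd hd (by omega); unfold Flips; omega
  · have := su hd (by omega); have := sd' (by omega) (by omega); unfold Flips; omega
  · have := sd hd (by omega); have := su' (by omega) (by omega); unfold Flips; omega

theorem innermost (h : IsTrajectory n y r) [Fintype ι] {T : ℤ} {p : ι} (h0 : 0 < r T)
    (hp : y T p = 1) {s : ℕ} (hs : s < 2 * n) : y (T + s) p = 2 * place n (r T) 1 s - 1 := by
  have hr := h.radius_le T
  have hstep : ∀ s : ℕ, s + 1 < 2 * n → _ := fun s hs =>
    h.cross_step (p := p) (T := T) (s := s) (by omega) (by omega) hs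
  unfold place
  rcases lt_or_ge s (r T) with h1 | h1
  · have := h.hold (T := T) (p := p) (j := 1) (s := s) (by push_cast; omega) le_rfl (by omega)
    push_cast at this
    omega
  rcases lt_or_ge (2 * n - 1 - s) (r T) with h2 | h2
  · have := h.hold_end (T := T) (p := p) (j := 1) (s := 2 * n - 1 - s) (by push_cast; omega)
      le_rfl (by omega)
    rw [show T + 2 * (n : ℤ) - 1 - (2 * n - 1 - s : ℕ) = T + s by omega] at this
    push_cast at this
    omega
  obtain ⟨N, hN⟩ := Nat.exists_eq_add_of_le hr
  obtain ⟨v, hv⟩ : ∃ v : ℕ → ℤ, ∀ s : ℕ, v s = y (T + s) p := ⟨_, fun _ => rfl⟩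
  have ho : ∀ s, v s % 2 = 1 := fun s => by rw [hv]; exact h.odd _ p
  have hv0 : v (r T - 1) = 1 := by
    rw [hv, h.hold (j := 1) (by push_cast; omega) le_rfl (by omega)]; rfl
  have hv1 : v (r T - 1 + (2 * N + 1)) = 1 := by
    have := h.hold_end (T := T) (p := p) (j := 1) (s := r T - 1) (by push_cast; omega) le_rfl
      (by omega)
    rw [show T + 2 * (n : ℤ) - 1 - (r T - 1 : ℕ) = T + (r T - 1 + (2 * N + 1) : ℕ) by omega] at this
    rw [hv, this]; rfl
  have hvpos : ∀ s < 2 * n, 0 < v s := fun s hs => by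
    rw [hv]; exact h.cross_pos (by omega) (by omega) hs
  have hvstep : ∀ s, s + 1 < 2 * n → v (s + 1) ≤ v s + 2 ∧ v s ≤ v (s + 1) + 2 := fun s hs => by
    rw [hv, hv]; push_cast; rw [← add_assoc]; exact (hstep s hs).2.2
  have hvturn : ∀ s, s + 2 < 2 * n → v (s + 2) = v s → v (s + 1) = v s := fun s hs => by
    rw [hv, hv, hv]; push_cast; rw [← add_assoc, ← add_assoc]; exact h.innermost_turn h0 hp hs
  have hvidle : ∀ k l, r T ≤ k + 1 → k < l → l + r T < 2 * n → v (k + 1) = v k →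
      v (l + 1) ≠ v l := fun k l => by
    rw [hv, hv, hv, hv]; push_cast; rw [← add_assoc, ← add_assoc]; exact h.innermost_idle h0 hp
  -- Between the two waiting phases lie `2 * N + 1` moves with `N = n - r T`; `u` counts places
  -- above the first.
  have key := tent_of_walk (N := N) (u := fun k => (v (r T - 1 + k) - 1) / 2)
    (by rw [add_zero, hv0]; rfl) (by rw [hv1]; rfl)
    (fun k hk => by have := hvpos (r T - 1 + k) (by omega); omega)
    (fun k hk => by
      have := hvstep (r T - 1 + k) (by omega)
      rw [← add_assoc]; omega)
    (fun k hk e => by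
      have a := ho (r T - 1 + k + 2)
      have b := ho (r T - 1 + k)
      have := hvturn (r T - 1 + k) (by omega)
      rw [← add_assoc] at e ⊢; rw [this (by omega)])
    (fun k l hkl hl ek el => by
      have a := ho (r T - 1 + k + 1)
      have b := ho (r T - 1 + k)
      have c := ho (r T - 1 + l + 1)
      have d := ho (r T - 1 + l)
      rw [← add_assoc] at ek el
      exact hvidle (r T - 1 + k) (r T - 1 + l) (by omega) (by omega) (by omega) (by omega)
        (by omega))
    (k := s - (r T - 1)) (by omega)
  have o := ho s
  rw [show r T - 1 + (s - (r T - 1)) = s by omega] at key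
  rw [← hv]
  omega

/-- The way of a point is determined by its position in its crossing switch. -/
theorem eq_place (h : IsTrajectory n y r) [Fintype ι] {T : ℤ} {p : ι} {j : ℕ}
    (hp : y T p = 2 * j - 1) (hj : 1 ≤ j) (hjr : j ≤ r T) {s : ℕ} (hs : s < 2 * n) :
    y (T + s) p = 2 * place n (r T) j s - 1 := by
  have hr := h.radius_le T
  apply le_antisymm
  · have top : ∀ i j p, y T p = 2 * (j : ℕ) - 1 → 1 ≤ j → j + i = r T →
        y (T + s) p ≤ 2 * ((n : ℤ) - r T + j) - 1 := by
      intro i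
      induction i with
      | zero =>
        intro j p hp hj hi
        have a := h.upper (T + s) p
        omega
      | succ i ih =>
        intro j p hp hj hi
        obtain ⟨q, hq⟩ := h.surjective T (2 * j + 1) (by omega) (by omega) (by omega)
        have a := ih (j + 1) q (by omega) (by omega) (by omega)
        have b := h.cross_order (T := T) (p := p) (q := q) (by omega) (by omega) (by omega) hs
        have c := h.odd (T + s) p
        have d := h.odd (T + s) q
        omega
    have a := top (r T - j) j p hp hj (by omega)
    have b : y (T + s) p ≤ 2 * max (j : ℤ) (2 * j - r T + s) - 1 := by
      rcases le_total (j + s) (r T) with hle | hle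
      · have := h.hold hp hj hle; omega
      · have b1 := h.hold (s := r T - j) hp hj (by omega)
        have b2 := h.cross_speed (T := T) (p := p) (s := r T - j) (k := s - (r T - j)) (by omega)
          (by omega) (by omega)
        rw [show T + ((r T - j : ℕ) : ℤ) + (s - (r T - j) : ℕ) = T + s by omega] at b2
        omega
    have c : y (T + s) p ≤ 2 * max (j : ℤ) (2 * j - r T + 2 * n - 1 - s) - 1 := by
      rcases le_total (j + (2 * n - 1 - s)) (r T) with hle | hle
      · have := h.hold_end hp hj hle
        rw [show T + 2 * (n : ℤ) - 1 - (2 * n - 1 - s : ℕ) = T + s by omega] at this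
        omega
      · have b1 := h.hold_end (s := r T - j) hp hj (by omega)
        have b2 := h.cross_speed (T := T) (p := p) (s := s) (k := 2 * n - 1 - s - (r T - j))
          (by omega) (by omega) (by omega)
        rw [show T + (s : ℤ) + (2 * n - 1 - s - (r T - j) : ℕ) =
          T + 2 * n - 1 - (r T - j : ℕ) by omega] at b2
        omega
    unfold place
    omega
  · induction j using Nat.strong_induction_on generalizing p s with
    | _ j ih =>
      obtain rfl | hj1 := hj.eq_or_lt
      · exact (h.innermost (by omega) (by push_cast at hp; omega) hs).ge
      -- The lower bound propagates outward from the innermost point: the next point inward, one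
      -- move later and one move earlier, is strictly below. The later comparison serves the ascent
      -- and the earlier one the descent.
      obtain ⟨q, hq⟩ := h.surjective T (2 * (j - 1 : ℕ) - 1) (by omega) (by omega) (by omega)
      have lo : 2 * (place n (r T) (j - 1 : ℕ) (s + 1) : ℤ) + 1 ≤ y (T + s) p ∨ s + 1 = 2 * n := by
        rcases Nat.lt_or_ge (s + 1) (2 * n) with h2 | h2
        · left
          have a := (h.cross_no_swap (T := T) (p := q) (q := p) (s := s) (by omega) (by omega)
            (by omega) h2).1
          have b := ih (j - 1) (by omega) hq (by omega) (by omega) h2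
          push_cast at b
          rw [← add_assoc] at b
          omega
        · right; omega
      have hi : 2 * (place n (r T) (j - 1 : ℕ) (s - 1) : ℤ) + 1 ≤ y (T + s) p ∨ s = 0 := by
        rcases Nat.eq_zero_or_pos s with h2 | h2
        · right; exact h2
        · left
          obtain ⟨s, rfl⟩ := Nat.exists_eq_add_of_le' h2
          have a := (h.cross_no_swap (T := T) (p := q) (q := p) (s := s) (by omega) (by omega)
            (by omega) hs).2
          have b := ih (j - 1) (by omega) hq (by omega) (by omega) (s := s) (by omega)
          push_cast
          rw [add_sub_cancel_right, ← add_assoc]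
          omega
      unfold place at *
      omega

/-! ### The crossing switches determine the trajectory. -/

/-- Every point takes part in a crossing switch within each halfperiod. -/
theorem exists_cross (h : IsTrajectory n y r) (T : ℤ) (p : ι) :
    ∃ s : ℕ, s < 2 * n ∧ -(2 * (r (T + s + 1) : ℤ)) < y (T + s + 1) p ∧
      y (T + s + 1) p < 2 * (r (T + s + 1) : ℤ) := by
  obtain ⟨q, hq⟩ := h.conj p
  have : p ≠ q := by
    rintro rfl
    have := hq 0; have := h.odd 0 p; omega
  obtain ⟨s, hs, hf⟩ := h.exists_flip this T
  refine ⟨s, hs, ?_⟩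
  have a := h.step (T + s + 1) p
  rw [show T + (s : ℤ) + 1 - 1 = T + s by ring] at a
  simp only [Flips, hq] at hf
  unfold CentralStep at a
  omega

theorem cross_unique (h : IsTrajectory n y r) {p : ι} {T T' : ℤ} (h1 : y T p < 2 * r T)
    (h2 : -(2 * (r T : ℤ)) < y T p) (h3 : y T' p < 2 * r T') (h4 : -(2 * (r T' : ℤ)) < y T' p)
    (hT : T < T') : T + 2 * n ≤ T' := by
  by_contra hc
  obtain ⟨q, hq⟩ := h.conj p
  have a := h.before_cross h1 h2
  have b := h.before_cross h3 h4
  have c := h.odd T p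
  have d := h.odd T' p
  refine h.once T T' p q hT (by omega) ?_ ?_ <;> simp only [Flips, hq] <;> omega

/-- Double counting: each of the `2 * n` points crosses exactly once per halfperiod, and the move
`τ` makes `2 * r τ` points cross. -/
theorem sum_radius (h : IsTrajectory n y r) [Fintype ι] (T : ℤ) :
    ∑ s ∈ Finset.range (2 * n), r (T + s + 1) = n := by
  classical
  choose φ hφ h1 h2 using fun p => h.exists_cross T p
  have := Finset.card_eq_sum_card_fiberwise (s := (Finset.univ : Finset ι))
    (t := Finset.range (2 * n)) (f := φ) (fun p _ => by simpa using hφ p)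
  rw [Finset.card_univ, h.card_points] at this
  have e : ∀ s ∈ Finset.range (2 * n), (Finset.univ.filter fun p => φ p = s).card =
      2 * r (T + s + 1) := by
    intro s hs
    rw [← h.card_cross]
    congr 1
    ext p
    simp only [Finset.mem_filter, Finset.mem_univ, true_and]
    constructor
    · rintro rfl; exact ⟨h1 p, h2 p⟩
    · rintro ⟨a, b⟩
      have := hφ p
      have hs' := Finset.mem_range.1 hs
      rcases lt_trichotomy (φ p) s with hlt | heq | hlt
      · have := h.cross_unique (h2 p) (h1 p) b a (by omega); omega
      · exact heq
      · have := h.cross_unique b a (h2 p) (h1 p) (by omega); omega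
  rw [Finset.sum_congr rfl e, ← Finset.mul_sum] at this
  omega

/-- Two trajectories with the same crossing switches and the same positions at one time agree. -/
theorem exists_eq (h : IsTrajectory n y r) [Fintype ι] {κ : Type*} [Fintype κ] {y' : ℤ → κ → ℤ}
    (h' : IsTrajectory n y' r) (p : ι) : ∃ q, ∀ τ, y' τ q = y τ p := by
  -- Starting at a crossing of `p`, both points follow the path given by `eq_place`, after
  -- reflection if `p` crosses downward; antiperiodicity extends the agreement to all times.
  obtain ⟨s₀, -, hlow, hup⟩ := h.exists_cross 0 p
  generalize (0 : ℤ) + s₀ + 1 = T at hlow hup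
  obtain ⟨q, hq⟩ := h'.surjective T (y T p) (h.odd _ _) (h.lower _ _) (h.upper _ _)
  refine ⟨q, ?_⟩
  have hn : (1 : ℤ) ≤ n := by have := h.lower T p; have := h.upper T p; omega
  have half : ∀ s : ℕ, s < 2 * n → y' (T + s) q = y (T + s) p := by
    intro s hs
    have o := h.odd T p
    rcases lt_or_gt_of_ne (show y T p ≠ 0 by omega) with hneg | hpos
    · have a := h.neg.eq_place (T := T) (p := p) (j := ((1 - y T p) / 2).toNat) (by omega) (by omega)
        (by omega) hs
      have b := h'.neg.eq_place (T := T) (p := q) (j := ((1 - y T p) / 2).toNat) (by omega) (by omega)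
        (by omega) hs
      omega
    · have a := h.eq_place (T := T) (p := p) (j := ((1 + y T p) / 2).toNat) (by omega) (by omega)
        (by omega) hs
      have b := h'.eq_place (T := T) (p := q) (j := ((1 + y T p) / 2).toNat) (by omega) (by omega)
        (by omega) hs
      omega
  have per : ∀ τ, y' τ q = y τ p ↔ y' (τ + 2 * n) q = y (τ + 2 * n) p := fun τ => by
    rw [h.antiperiodic, h'.antiperiodic, neg_inj]
  have up : ∀ k : ℕ, ∀ τ, T ≤ τ → τ < T + 2 * n * (k + 1) → y' τ q = y τ p := by
    intro k
    induction k with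
    | zero =>
      intro τ h1 h2
      have := half (τ - T).toNat (by push_cast at h2; omega)
      rwa [show T + ((τ - T).toNat : ℤ) = τ by omega] at this
    | succ k ih =>
      intro τ h1 h2
      rcases lt_or_ge τ (T + 2 * n) with h3 | h3
      · have := half (τ - T).toNat (by omega)
        rwa [show T + ((τ - T).toNat : ℤ) = τ by omega] at this
      · have := (per _).1 (ih (τ - 2 * n) (by omega) (by push_cast at h2; linarith))
        rwa [sub_add_cancel] at this
  have down : ∀ k : ℕ, ∀ τ, T ≤ τ + 2 * n * k → y' τ q = y τ p := by
    intro k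
    induction k with
    | zero =>
      intro τ h1
      refine up (τ - T).toNat τ (by simpa using h1) ?_
      have : ((τ - T).toNat : ℤ) = τ - T := by simp at h1; omega
      rw [this]
      have h2 : 0 ≤ (2 * (n : ℤ) - 1) * (τ - T + 1) := mul_nonneg (by omega) (by omega)
      linarith
    | succ k ih =>
      intro τ h1
      exact (per _).2 (ih _ (by push_cast at h1; linarith))
  intro τ
  refine down (T - τ).toNat τ ?_
  have : T - τ ≤ ((T - τ).toNat : ℤ) := Int.self_le_toNat _
  have h2 : 0 ≤ (2 * (n : ℤ) - 1) * (T - τ).toNat := mul_nonneg (by omega) (by omega)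
  linarith

end IsTrajectory

/-! ### Crossing times from the signature. -/

/-- Lifts a rotation of the signature, where moves without crossing are dropped, to a rotation of
the full list of moves, that is, to a shift of time. -/
theorem List.IsRotated.exists_filter_eq {α : Type*} {p : α → Bool} {l L : List α}
    (h : List.IsRotated (l.filter p) L) : ∃ k ≤ l.length, (l.rotate k).filter p = L := by
  obtain ⟨k, rfl⟩ := h
  rw [List.rotate_eq_drop_append_take_mod]
  obtain ⟨l₁, l₂, rfl, h1, h2⟩ := List.filter_eq_append_iff.1
    (List.take_append_drop (k % (l.filter p).length) (l.filter p)).symm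
  refine ⟨l₁.length, by simp, ?_⟩
  rw [List.rotate_append_length_eq, List.filter_append, h1, h2]

/-- The intervals of length `2 * f τ` centered at `τ` tile the integers, with period `2 * n`. -/
structure IsPeriodicTiling (n : ℕ) (f : ℤ → ℕ) : Prop where
  periodic : ∀ τ, f (τ + 2 * n) = f τ
  gap : ∀ T T' : ℤ, T < T' → T' < T + 2 * n → 0 < f T → 0 < f T' → (f T : ℤ) + f T' ≤ T' - T
  sum : ∀ T : ℤ, ∑ s ∈ Finset.range (2 * n), f (T + s + 1) = n

theorem IsTrajectory.isPeriodicTiling {ι : Type*} [Fintype ι] {n : ℕ} {y : ℤ → ι → ℤ} {r : ℤ → ℕ}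
    (h : IsTrajectory n y r) : IsPeriodicTiling n r :=
  ⟨h.radius_periodic, fun _ _ => h.gap, h.sum_radius⟩

namespace IsPeriodicTiling

variable {n : ℕ} {f g : ℤ → ℕ}

theorem shift (h : IsPeriodicTiling n f) (k : ℤ) : IsPeriodicTiling n fun τ => f (τ + k) where
  periodic τ := by rw [← h.periodic (τ + k), add_right_comm]
  gap T T' h1 h2 h3 h4 := by have := h.gap _ _ (by omega) (by omega) h3 h4; omega
  sum T := by
    refine Eq.trans (Finset.sum_congr rfl fun s _ => ?_) (h.sum (T + k))
    congr 1; ring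

theorem add_mul (h : IsPeriodicTiling n f) (τ z : ℤ) : f (τ + 2 * n * z) = f τ := by
  have : Function.Periodic f (2 * n : ℤ) := h.periodic
  rw [mul_comm]
  exact this.int_mul z τ

/-- The successive positive values of `f` on `1, …, 2 * n`. -/
def signature (n : ℕ) (f : ℤ → ℕ) : List ℕ :=
  ((List.range (2 * n)).map fun k : ℕ => f ((k : ℤ) + 1)).filter fun d => 0 < d

theorem exists_shift_signature (h : IsPeriodicTiling n f) {L : List ℕ}
    (hL : List.IsRotated (signature n f) L) : ∃ k : ℤ, signature n (fun τ => f (τ + k)) = L := by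
  obtain ⟨k, -, hk⟩ := List.IsRotated.exists_filter_eq hL
  refine ⟨k, ?_⟩
  rw [← hk, signature]
  congr 1
  apply List.ext_getElem
  · simp
  · intro i h1 h2
    simp only [List.getElem_map, List.getElem_range, List.getElem_rotate, List.length_map,
      List.length_range]
    rw [← h.add_mul (((i + k) % (2 * n) : ℕ) + 1) ((i + k) / (2 * n) : ℕ)]
    congr 1
    have := Nat.mod_add_div (i + k) (2 * n)
    zify at this ⊢
    linarith

/-- The times in `0, …, 2 * n - 1` that precede a positive value of `f`. -/
def times (n : ℕ) (f : ℤ → ℕ) : List ℕ := (List.range (2 * n)).filter fun k : ℕ => 0 < f ((k : ℤ) + 1)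

theorem signature_eq_map : signature n f = (times n f).map fun k : ℕ => f ((k : ℤ) + 1) := by
  rw [signature, times, List.filter_map]; rfl

theorem length_times : (times n f).length = (signature n f).length := by
  rw [signature_eq_map, List.length_map]

theorem signature_getD {i : ℕ} (hi : i < (times n f).length) :
    (signature n f).getD i 0 = f (((times n f).getD i 0 : ℕ) + 1) := by
  rw [signature_eq_map, List.getD_eq_getElem _ _ (by simpa using hi), List.getElem_map,
    List.getD_eq_getElem _ _ hi]

theorem mem_times {k : ℕ} : k ∈ times n f ↔ k < 2 * n ∧ 0 < f ((k : ℤ) + 1) := by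
  simp [times]

theorem times_lt {i j : ℕ} (hij : i < j) (hj : j < (times n f).length) :
    (times n f).getD i 0 < (times n f).getD j 0 := by
  have : (times n f).Pairwise (· < ·) := List.pairwise_lt_range.filter _
  rw [List.getD_eq_getElem _ _ hj, List.getD_eq_getElem _ _ (hij.trans hj)]
  exact List.pairwise_iff_getElem.1 this _ _ _ _ hij

theorem getD_mem_times {i : ℕ} (hi : i < (times n f).length) :
    (times n f).getD i 0 < 2 * n ∧ 0 < f (((times n f).getD i 0 : ℕ) + 1) := by
  rw [List.getD_eq_getElem _ _ hi]
  exact mem_times.1 (List.getElem_mem hi)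

theorem sum_signature (h : IsPeriodicTiling n f) : (signature n f).sum = n := by
  have : ∀ l : List ℕ, (l.filter fun d => 0 < d).sum = l.sum := by
    intro l
    induction l with
    | nil => rfl
    | cons a l ih =>
      rcases Nat.eq_zero_or_pos a with rfl | ha
      · simpa using ih
      · simp [ha, ih]
  rw [signature, this]
  refine Eq.trans ?_ (h.sum 0)
  rw [Finset.sum, Finset.range_val, Multiset.range, Multiset.map_coe, Multiset.sum_coe]
  simp

/-- The times of the crossing switches are determined by the signature, up to a shift. -/
theorem times_eq (h : IsPeriodicTiling n f) (hlen : 1 < (times n f).length) {i : ℕ}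
    (hi : i < (times n f).length) :
    ((times n f).getD i 0 : ℤ) + (signature n f).getD 0 0 = (times n f).getD 0 0 +
      2 * ∑ k ∈ Finset.range i, (signature n f).getD k 0 + (signature n f).getD i 0 := by
  -- `D i` is the offset of the `i`-th time from its tightly packed value. The gaps make `D`
  -- nondecreasing, and the gap closing the cycle gives `last`, so `D` is constant.
  obtain ⟨D, hD⟩ : ∃ D : ℕ → ℤ, ∀ i, D i = (times n f).getD i 0 -
    (2 * ∑ k ∈ Finset.range i, (signature n f).getD k 0 + (signature n f).getD i 0 : ℕ) :=
    ⟨_, fun _ => rfl⟩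
  have mono : ∀ i j, i ≤ j → j < (times n f).length → D i ≤ D j := by
    intro i j hij
    induction j, hij using Nat.le_induction with
    | base => intro _; exact le_rfl
    | succ j hij ih =>
      intro hj
      refine (ih (by omega)).trans ?_
      have a := times_lt (n := n) (f := f) (i := j) (j := j + 1) (by omega) hj
      have b := getD_mem_times (n := n) (f := f) hj
      have c := getD_mem_times (n := n) (f := f) (Nat.lt_of_succ_lt hj)
      have := h.gap (((times n f).getD j 0 : ℕ) + 1) (((times n f).getD (j + 1) 0 : ℕ) + 1)
        (by omega) (by omega) c.2 b.2
      rw [← signature_getD hj, ← signature_getD (Nat.lt_of_succ_lt hj)] at this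
      rw [hD, hD, Finset.sum_range_succ]
      push_cast
      omega
  obtain ⟨t, ht⟩ : ∃ t, (times n f).length = t + 1 := ⟨(times n f).length - 1, by omega⟩
  have last : D t ≤ D 0 := by
    -- With at least two crossings, the first one of the next period comes less than `2 * n` after
    -- the last, so `gap` applies to this pair.
    have a := times_lt (n := n) (f := f) (i := 0) (j := t) (by omega) (by omega)
    have b := getD_mem_times (n := n) (f := f) (i := 0) (by omega)
    have c := getD_mem_times (n := n) (f := f) (i := t) (by omega)
    have e : f (((times n f).getD 0 0 : ℕ) + 1 + 2 * n) = f (((times n f).getD 0 0 : ℕ) + 1) :=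
      h.periodic _
    have := h.gap (((times n f).getD t 0 : ℕ) + 1) (((times n f).getD 0 0 : ℕ) + 1 + 2 * n)
      (by omega) (by omega) c.2 (by rw [e]; exact b.2)
    rw [e, ← signature_getD (n := n) (f := f) (i := t) (by omega),
      ← signature_getD (n := n) (f := f) (i := 0) (by omega)] at this
    have hs : ∑ k ∈ Finset.range (t + 1), (signature n f).getD k 0 = n := by
      refine Eq.trans ?_ h.sum_signature
      rw [← ht, length_times, Finset.sum_range]
      conv_rhs => rw [← List.ofFn_getElem (xs := signature n f), List.sum_ofFn]
      exact Finset.sum_congr rfl fun k _ => List.getD_eq_getElem _ _ k.2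
    rw [Finset.sum_range_succ] at hs
    rw [hD, hD]
    simp only [Finset.range_zero, Finset.sum_empty]
    omega
  have a := mono 0 i (by omega) hi
  have b := mono i t (by omega) (by omega)
  have e : D i = D 0 := by omega
  rw [hD, hD] at e
  simp only [Finset.range_zero, Finset.sum_empty] at e
  push_cast at e ⊢
  omega

theorem exists_mem_times (h : IsPeriodicTiling n f) (hn : 0 < n) {τ : ℤ} (hτ : 0 < f τ) :
    ∃ i < (times n f).length, ∃ z : ℤ, τ = ((times n f).getD i 0 : ℕ) + 1 + 2 * n * z := by
  have e := Int.emod_add_mul_ediv (τ - 1) (2 * n)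
  have h0 := Int.emod_nonneg (τ - 1) (b := 2 * n) (by omega)
  have h1 := Int.emod_lt_of_pos (τ - 1) (b := 2 * n) (by omega)
  obtain ⟨k, hk⟩ := Int.eq_ofNat_of_zero_le h0
  have hmem : k ∈ times n f := by
    rw [mem_times]
    refine ⟨by omega, ?_⟩
    rwa [← h.add_mul _ ((τ - 1) / (2 * n)), ← hk, show
      (τ - 1) % (2 * n) + 1 + 2 * n * ((τ - 1) / (2 * n)) = τ by linarith]
  obtain ⟨i, hi, rfl⟩ := List.getElem_of_mem hmem
  refine ⟨i, hi, (τ - 1) / (2 * n), ?_⟩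
  rw [List.getD_eq_getElem _ _ hi]
  linarith

theorem eq_of_signature_eq (hf : IsPeriodicTiling n f) (hg : IsPeriodicTiling n g)
    (h : signature n f = signature n g) (hlen : 1 < (signature n f).length) :
    ∃ k : ℤ, ∀ τ, g (τ + k) = f τ := by
  have key : ∀ f g : ℤ → ℕ, IsPeriodicTiling n f → IsPeriodicTiling n g →
      signature n f = signature n g → 1 < (signature n f).length → ∀ τ, 0 < f τ →
      g (τ + ((times n g).getD 0 0 - (times n f).getD 0 0)) = f τ := by
    intro f g hf hg h hlen τ hτ
    have hn : 0 < n := by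
      rcases Nat.eq_zero_or_pos n with rfl | hn
      · simp [signature] at hlen
      · exact hn
    obtain ⟨i, hi, z, rfl⟩ := hf.exists_mem_times hn hτ
    have hi' : i < (times n g).length := by rwa [length_times, ← h, ← length_times]
    have a := hf.times_eq (by rwa [length_times]) hi
    have b := hg.times_eq (by rwa [length_times, ← h]) hi'
    rw [hf.add_mul, ← signature_getD hi, h, signature_getD hi', ← hg.add_mul (((times n g).getD i 0 : ℕ) + 1) z]
    congr 1
    rw [h] at a
    linarith
  refine ⟨(times n g).getD 0 0 - (times n f).getD 0 0, fun τ => ?_⟩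
  rcases Nat.eq_zero_or_pos (f τ) with h0 | h0
  -- A positive value of `g` here would be carried back by `key` to a positive `f τ`.
  · by_contra hc
    have := key g f hg hf h.symm (h ▸ hlen)
      (τ + ((times n g).getD 0 0 - (times n f).getD 0 0)) (by omega)
    rw [add_assoc, sub_add_sub_cancel, sub_self, add_zero] at this
    omega
  · exact key f g hf hg h hlen τ h0

end IsPeriodicTiling

/-! ### Between moves of words and steps of coordinates. -/

theorem CentralStep.swap_down {ι : Type*} {f g : ι → ℤ} {r N : ℤ} (hg : Function.Injective g)
    (hf : ∀ z : ℤ, z % 2 = 1 → -N < z → z < N → ∃ p, f p = z)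
    (hfo : ∀ p, f p % 2 = 1) (hgo : ∀ p, g p % 2 = 1) (hfN : ∀ p, f p < N) (hgl : ∀ p, -N < g p)
    (h : ∀ p, CentralStep r (f p) (g p)) (p q : ι) (hp : g p = f p - 2) (hq : f q = f p - 2) :
    g q = f p := by
  have := CentralStep.swap_up (f := fun p => -f p) (g := fun p => -g p) (r := r) (N := N)
    (fun a b e => hg (neg_inj.1 e))
    (fun z h1 h2 h3 => (hf (-z) (by omega) (by omega) (by omega)).imp fun p hp => by omega)
    (fun p => by have := hfo p; omega) (fun p => by have := hgo p; omega)
    (fun p => by have := hfN p; omega) (fun p => by have := hgl p; omega)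
    (fun p => (h p).neg) p q (by omega) (by omega)
  omega

namespace IsMove

variable {m : ℕ} {S : Finset (Fin m × Fin m)} {π π' : PointOrder m}

theorem symm_add_symm (h : IsMove S π π') {s : Fin m × Fin m} (hs : s ∈ S) {p : Fin m}
    (hp : π.symm p ∈ Finset.Icc s.1 s.2) :
    (π'.symm p : ℕ) + (π.symm p : ℕ) = (s.1 : ℕ) + (s.2 : ℕ) := by
  obtain ⟨h1, h2⟩ := Finset.mem_Icc.1 hp
  have h3 := (π.symm p).isLt
  have h1' : (s.1 : ℕ) ≤ π.symm p := h1
  have h2' : (π.symm p : ℕ) ≤ s.2 := h2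
  have := h.reversed s hs ⟨(s.1 : ℕ) + s.2 - π.symm p, by omega⟩ (π.symm p)
    (Fin.le_def.2 (by simp only; omega)) (Fin.le_def.2 (by simp only; omega)) (by simp only; omega)
  rw [Equiv.apply_symm_apply, ← Equiv.eq_symm_apply] at this
  rw [← this]
  simp only
  omega

theorem symm_eq_symm (h : IsMove S π π') {p : Fin m}
    (hp : ∀ s ∈ S, π.symm p ∉ Finset.Icc s.1 s.2) : π'.symm p = π.symm p := by
  have := h.unchanged _ hp
  rw [Equiv.apply_symm_apply, ← Equiv.eq_symm_apply] at this
  exact this.symm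

theorem lt_or_lt (h : IsMove S π π') {s s' : Fin m × Fin m} (hs : s ∈ S) (hs' : s' ∈ S)
    (hne : s ≠ s') : s.2 < s'.1 ∨ s'.2 < s.1 := by
  have a := h.disjoint s hs s' hs' hne
  have b := h.lt s hs
  have c := h.lt s' hs'
  rw [Finset.disjoint_left] at a
  have d := a (Finset.left_mem_Icc.2 b.le)
  have e : s'.1 ∉ Finset.Icc s.1 s.2 := fun hh => a hh (Finset.left_mem_Icc.2 c.le)
  simp only [Finset.mem_Icc] at d e
  omega

/-- Two points take part in a common switch if and only if the move reverses their order. -/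
theorem together_iff (h : IsMove S π π') {p q : Fin m} (hpq : p ≠ q) :
    (∃ s ∈ S, π.symm p ∈ Finset.Icc s.1 s.2 ∧ π.symm q ∈ Finset.Icc s.1 s.2) ↔
      (π.symm p < π.symm q ∧ π'.symm q < π'.symm p) ∨
        (π.symm q < π.symm p ∧ π'.symm p < π'.symm q) := by
  have hne : π.symm p ≠ π.symm q := fun e => hpq (π.symm.injective e)
  constructor
  · rintro ⟨s, hs, hp, hq⟩
    have a := h.symm_add_symm hs hp
    have b := h.symm_add_symm hs hq
    omega
  · intro hf
    have key : ∀ p, (∃ s ∈ S, π.symm p ∈ Finset.Icc s.1 s.2 ∧ π'.symm p ∈ Finset.Icc s.1 s.2) ∨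
        ((∀ s ∈ S, π.symm p ∉ Finset.Icc s.1 s.2) ∧ π'.symm p = π.symm p) := by
      intro p
      by_cases hex : ∃ s ∈ S, π.symm p ∈ Finset.Icc s.1 s.2
      · obtain ⟨s, hs, hp⟩ := hex
        refine Or.inl ⟨s, hs, hp, ?_⟩
        have := h.symm_add_symm hs hp
        rw [Finset.mem_Icc] at hp ⊢
        omega
      · push Not at hex
        exact Or.inr ⟨hex, h.symm_eq_symm hex⟩
    rcases key p with ⟨s, hs, hp, hp'⟩ | ⟨hp, hp'⟩ <;> rcases key q with ⟨t, ht, hq, hq'⟩ | ⟨hq, hq'⟩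
    · by_cases hst : s = t
      · subst hst; exact ⟨s, hs, hp, hq⟩
      · have := h.lt_or_lt hs ht hst
        simp only [Finset.mem_Icc] at hp hp' hq hq'
        omega
    · have := hq s hs
      simp only [Finset.mem_Icc] at this hp hp'
      omega
    · have := hp t ht
      simp only [Finset.mem_Icc] at this hq hq'
      omega
    · omega

/-- Disjointness allows only one centered switch. Any other switch is a transposition and cannot
straddle the center, for two adjacent positions astride the center form a centered substring; so its
points stay on their side, also when the radius is `0`. -/
theorem centralStep {n : ℕ} {S : Finset (Fin (2 * n) × Fin (2 * n))} {π π' : PointOrder (2 * n)}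
    (h : IsMove S π π') (hS : ∀ s ∈ S, ¬ IsCentered s → (s.2 : ℕ) = (s.1 : ℕ) + 1) (p : Fin (2 * n)) :
    CentralStep (∑ s ∈ S.filter IsCentered, ((s.2 : ℕ) + 1 - (s.1 : ℕ)) / 2 : ℕ)
      (2 * ((π.symm p : ℕ) : ℤ) + 1 - (2 * n : ℕ)) (2 * ((π'.symm p : ℕ) : ℤ) + 1 - (2 * n : ℕ)) := by
  have hp := (π.symm p).isLt
  by_cases hex : ∃ s ∈ S, IsCentered s
  · obtain ⟨c, hc, hcc⟩ := hex
    have hfil : S.filter IsCentered = {c} := by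
      ext s
      rw [Finset.mem_filter, Finset.mem_singleton]
      refine ⟨fun ⟨hs, hsc⟩ => ?_, fun e => e ▸ ⟨hc, hcc⟩⟩
      by_contra hne
      have a := h.lt_or_lt hs hc hne
      have b := h.lt s hs
      have d := h.lt c hc
      unfold IsCentered at hsc hcc
      omega
    rw [hfil, Finset.sum_singleton]
    have d := h.lt c hc
    unfold IsCentered at hcc
    unfold CentralStep
    by_cases hin : ∃ s ∈ S, π.symm p ∈ Finset.Icc s.1 s.2
    · obtain ⟨s, hs, hps⟩ := hin
      have a := h.symm_add_symm hs hps
      rw [Finset.mem_Icc] at hps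
      by_cases hsc : s = c
      · subst hsc
        omega
      · have b := h.lt_or_lt hs hc hsc
        have e := hS s hs (fun hs' => hsc (by
          have := Finset.mem_filter.2 ⟨hs, hs'⟩
          rwa [hfil, Finset.mem_singleton] at this))
        omega
    · push Not at hin
      have a := h.symm_eq_symm hin
      have b := hin c hc
      rw [Finset.mem_Icc] at b
      omega
  · push Not at hex
    rw [Finset.filter_false_of_mem hex, Finset.sum_empty]
    unfold CentralStep
    by_cases hin : ∃ s ∈ S, π.symm p ∈ Finset.Icc s.1 s.2
    · obtain ⟨s, hs, hps⟩ := hin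
      have a := h.symm_add_symm hs hps
      have b := hS s hs (hex s hs)
      have c := hex s hs
      rw [Finset.mem_Icc] at hps
      unfold IsCentered at c
      omega
    · push Not at hin
      have a := h.symm_eq_symm hin
      omega

theorem radius_le {n : ℕ} {S : Finset (Fin (2 * n) × Fin (2 * n))} {π π' : PointOrder (2 * n)}
    (h : IsMove S π π') : ∑ s ∈ S.filter IsCentered, ((s.2 : ℕ) + 1 - (s.1 : ℕ)) / 2 ≤ n := by
  by_cases hex : ∃ s ∈ S, IsCentered s
  · obtain ⟨c, hc, hcc⟩ := hex
    have hfil : S.filter IsCentered = {c} := by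
      ext s
      rw [Finset.mem_filter, Finset.mem_singleton]
      refine ⟨fun ⟨hs, hsc⟩ => ?_, fun e => e ▸ ⟨hc, hcc⟩⟩
      by_contra hne
      have a := h.lt_or_lt hs hc hne
      have b := h.lt s hs
      have d := h.lt c hc
      unfold IsCentered at hsc hcc
      omega
    rw [hfil, Finset.sum_singleton]
    omega
  · push Not at hex
    rw [Finset.filter_false_of_mem hex, Finset.sum_empty]
    exact Nat.zero_le n

end IsMove

namespace AllowableSequence

/-- Twice the signed distance of the point `p` from the center of the `τ`-th word. -/
def coord {m : ℕ} (A : AllowableSequence m) (τ : ℤ) (p : Fin m) : ℤ :=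
  2 * (((A.perm τ).symm p : ℕ) : ℤ) + 1 - m

theorem coord_inj {m : ℕ} (A : AllowableSequence m) {τ : ℤ} {p q : Fin m}
    (h : A.coord τ p = A.coord τ q) : p = q := by
  unfold coord at h
  exact (A.perm τ).symm.injective (Fin.ext (by omega))

theorem flips_coord_iff {m : ℕ} (A : AllowableSequence m) (i : ℤ) {p q : Fin m} (hpq : p ≠ q) :
    Flips (A.coord (i - 1)) (A.coord i) p q ↔ ∃ s ∈ A.switches i,
      (A.perm (i - 1)).symm p ∈ Finset.Icc s.1 s.2 ∧
        (A.perm (i - 1)).symm q ∈ Finset.Icc s.1 s.2 := by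
  rw [(A.isMove i).together_iff hpq]
  unfold Flips coord
  omega

theorem isTrajectory {n : ℕ} (A : AllowableSequence (2 * n)) (h1 : A.halfLength = 2 * n)
    (h2 : A.IsCentrallySymmetric) (h3 : A.IsInNoncentralGeneralPosition) :
    IsTrajectory n A.coord A.crossingSize where
  injective τ p q := A.coord_inj
  surjective τ z hz hl hu := by
    refine ⟨A.perm τ ⟨((z + 2 * n - 1) / 2).toNat, by omega⟩, ?_⟩
    unfold coord
    rw [Equiv.symm_apply_apply]
    push_cast
    omega
  odd τ p := by unfold coord; push_cast; omega
  lower τ p := by unfold coord; push_cast; omega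
  upper τ p := by unfold coord; have := ((A.perm τ).symm p).isLt; push_cast; omega
  radius_le τ := (A.isMove τ).radius_le
  antiperiodic τ p := by
    have := A.reversal τ (Fin.rev ((A.perm τ).symm p))
    rw [Fin.rev_rev, Equiv.apply_symm_apply, ← Equiv.eq_symm_apply, h1] at this
    unfold coord
    push_cast at this ⊢
    rw [← this, Fin.val_rev]
    omega
  conj p := by
    obtain ⟨q, hq⟩ := h2 p
    refine ⟨q, fun τ => ?_⟩
    have := hq τ
    unfold coord
    push_cast
    omega
  step τ p := (A.isMove τ).centralStep (h3 τ) p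
  once τ τ' p q ht ht' hf hf' := by
    have hpq : p ≠ q := by rintro rfl; unfold Flips at hf; omega
    obtain ⟨i, -, hi⟩ := A.pair_once (τ - 1) p q hpq
    have a := hi τ ⟨⟨by omega, by rw [h1]; omega⟩, (A.flips_coord_iff τ hpq).1 hf⟩
    have b := hi τ' ⟨⟨by omega, by rw [h1]; push_cast; omega⟩, (A.flips_coord_iff τ' hpq).1 hf'⟩
    omega

theorem centralSignature_eq {n : ℕ} (A : AllowableSequence (2 * n)) (h1 : A.halfLength = 2 * n) :
    A.centralSignature = IsPeriodicTiling.signature n A.crossingSize := by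
  unfold centralSignature IsPeriodicTiling.signature
  rw [h1]
  congr 1
  simp [← List.map_eq_flatMap]

/-- An allowable sequence with the given coordinates of the points. -/
theorem exists_of_coord {n : ℕ} {y : ℤ → Fin (2 * n) → ℤ} {r : ℤ → ℕ} (hn : 0 < n)
    (injective : ∀ τ, Function.Injective (y τ)) (odd : ∀ τ p, y τ p % 2 = 1)
    (lower : ∀ τ p, -(2 * n : ℤ) < y τ p) (upper : ∀ τ p, y τ p < 2 * n) (radius_le : ∀ τ, r τ ≤ n)
    (antiperiodic : ∀ τ p, y (τ + 2 * n) p = -y τ p)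
    (step : ∀ τ p, CentralStep (r τ) (y (τ - 1) p) (y τ p))
    (active : ∀ τ, r τ = 0 → ∃ p, y τ p = y (τ - 1) p + 2)
    (once : ∀ (j : ℤ) p q, p ≠ q → ∃! i, i ∈ Set.Ioc j (j + 2 * n) ∧ Flips (y (i - 1)) (y i) p q) :
    ∃ A : AllowableSequence (2 * n), A.halfLength = 2 * n ∧ A.IsInNoncentralGeneralPosition ∧
      (∀ τ p, A.coord τ p = y τ p) ∧ ∀ τ, A.crossingSize τ = r τ := by
  have hpos : ∀ τ p, ((y τ p + 2 * n - 1) / 2).toNat < 2 * n := fun τ p => by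
    have := upper τ p; have := lower τ p; have := odd τ p; omega
  let pos : ℤ → Fin (2 * n) → Fin (2 * n) := fun τ p => ⟨((y τ p + 2 * n - 1) / 2).toNat, hpos τ p⟩
  have hposy : ∀ τ p, 2 * ((pos τ p : ℕ) : ℤ) + 1 - 2 * n = y τ p := fun τ p => by
    have := upper τ p; have := lower τ p; have := odd τ p
    simp only [pos]; omega
  have hinj : ∀ τ, Function.Injective (pos τ) := fun τ p q e => injective τ (by
    rw [← hposy, ← hposy, e])
  let perm : ℤ → PointOrder (2 * n) := fun τ =>
    (Equiv.ofBijective (pos τ) (Finite.injective_iff_bijective.1 (hinj τ))).symm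
  have hsymm : ∀ τ p, (perm τ).symm p = pos τ p := fun τ p => rfl
  have hperm : ∀ τ x, y τ (perm τ x) = 2 * ((x : ℕ) : ℤ) + 1 - 2 * n := fun τ x => by
    rw [← hposy, ← hsymm, Equiv.symm_apply_apply]
  have eq_perm : ∀ τ (x : Fin (2 * n)) p, y τ p = 2 * ((x : ℕ) : ℤ) + 1 - 2 * n → perm τ x = p := fun τ x p e =>
    injective τ (by rw [hperm, e])
  have surj : ∀ τ z, z % 2 = 1 → -(2 * n : ℤ) < z → z < 2 * n → ∃ p, y τ p = z :=
    fun τ z h1 h2 h3 => ⟨perm τ ⟨((z + 2 * n - 1) / 2).toNat, by omega⟩, by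
      rw [hperm]; simp only; omega⟩
  have up : ∀ τ p q, y τ p = y (τ - 1) p + 2 → y (τ - 1) q = y (τ - 1) p + 2 →
      y τ q = y (τ - 1) p := fun τ => CentralStep.swap_up (injective τ) (surj _) (odd _) (odd _)
    (lower _) (upper _) (step τ)
  have down : ∀ τ p q, y τ p = y (τ - 1) p - 2 → y (τ - 1) q = y (τ - 1) p - 2 →
      y τ q = y (τ - 1) p := fun τ => CentralStep.swap_down (injective τ) (surj _) (odd _) (odd _)
    (upper _) (lower _) (step τ)
  -- An off-center transposition is recorded by its lower position, whose point moves up; the second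
  -- alternative is the crossing switch.
  let sw : ℤ → Finset (Fin (2 * n) × Fin (2 * n)) := fun τ => Finset.univ.filter fun s =>
    ((s.2 : ℕ) = s.1 + 1 ∧ ¬ IsCentered s ∧
      y τ (perm (τ - 1) s.1) = y (τ - 1) (perm (τ - 1) s.1) + 2) ∨
    (0 < r τ ∧ (s.1 : ℕ) + r τ = n ∧ (s.2 : ℕ) + 1 = n + r τ)
  have mem_sw : ∀ τ s, s ∈ sw τ ↔ ((s.2 : ℕ) = s.1 + 1 ∧ ¬ IsCentered s ∧
      y τ (perm (τ - 1) s.1) = y (τ - 1) (perm (τ - 1) s.1) + 2) ∨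
      (0 < r τ ∧ (s.1 : ℕ) + r τ = n ∧ (s.2 : ℕ) + 1 = n + r τ) := fun τ s => by
    simp only [sw, Finset.mem_filter, Finset.mem_univ, true_and]
  -- Only a point rising from `-1` to `1` gives no transposition: it belongs to a crossing switch of
  -- two points.
  have up_mem : ∀ τ p, y τ p = y (τ - 1) p + 2 → 0 < r τ ∧ y (τ - 1) p = -1 ∨
      ∃ s ∈ sw τ, (s.1 : ℕ) = pos (τ - 1) p ∧ (s.2 : ℕ) = pos (τ - 1) p + 1 := by
    intro τ p hp
    have a := hposy τ p
    have b := hposy (τ - 1) p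
    have c := step τ p
    have hl := (pos τ p).isLt
    rw [or_iff_not_imp_left]
    intro h0
    refine ⟨(pos (τ - 1) p, ⟨pos (τ - 1) p + 1, by omega⟩), (mem_sw _ _).2 (Or.inl ⟨rfl, ?_, ?_⟩),
      rfl, rfl⟩
    · unfold IsCentered CentralStep at *
      simp only
      omega
    · simp only
      rw [← hsymm, Equiv.apply_symm_apply]
      exact hp
  have single : ∀ τ s, s ∈ sw τ → ¬ (0 < r τ ∧ (s.1 : ℕ) + r τ = n ∧ (s.2 : ℕ) + 1 = n + r τ) →
      (s.2 : ℕ) = s.1 + 1 ∧ y τ (perm (τ - 1) s.1) = y (τ - 1) (perm (τ - 1) s.1) + 2 ∧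
      y τ (perm (τ - 1) s.2) = y (τ - 1) (perm (τ - 1) s.1) ∧
      ((s.2 : ℕ) + r τ < n ∨ n + r τ ≤ s.1) := by
    intro τ s hs hn
    obtain ⟨h1, h2, h3⟩ := ((mem_sw τ s).1 hs).resolve_right hn
    have a := hperm (τ - 1) s.1
    have b := hperm (τ - 1) s.2
    have c := step τ (perm (τ - 1) s.1)
    refine ⟨h1, h3, up τ _ _ h3 (by omega), ?_⟩
    unfold IsCentered CentralStep at *
    omega
  have move : ∀ τ, IsMove (sw τ) (perm (τ - 1)) (perm τ) := by
    intro τ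
    have hr := radius_le τ
    constructor
    · rcases Nat.eq_zero_or_pos (r τ) with h0 | h0
      · obtain ⟨p, hp⟩ := active τ h0
        rcases up_mem τ p hp with h | ⟨s, hs, -⟩
        · omega
        · exact ⟨s, hs⟩
      · exact ⟨(⟨n - r τ, by omega⟩, ⟨n + r τ - 1, by omega⟩),
          (mem_sw _ _).2 (Or.inr ⟨h0, by simp only; omega, by simp only; omega⟩)⟩
    · intro s hs
      rw [Fin.lt_def]
      rcases (mem_sw τ s).1 hs with h | h <;> omega
    · intro s hs s' hs' hne
      rw [Finset.disjoint_left]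
      intro x hx hx'
      rw [Finset.mem_Icc, Fin.le_def, Fin.le_def] at hx hx'
      rw [ne_eq, Prod.ext_iff, Fin.ext_iff, Fin.ext_iff] at hne
      by_cases hc : 0 < r τ ∧ (s.1 : ℕ) + r τ = n ∧ (s.2 : ℕ) + 1 = n + r τ <;>
        by_cases hc' : 0 < r τ ∧ (s'.1 : ℕ) + r τ = n ∧ (s'.2 : ℕ) + 1 = n + r τ
      · omega
      · have := single τ s' hs' hc'; omega
      · have := single τ s hs hc; omega
      · obtain ⟨a1, a2, a3, -⟩ := single τ s hs hc
        obtain ⟨b1, b2, b3, -⟩ := single τ s' hs' hc'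
        have e1 := hperm (τ - 1) s.1
        have e2 := hperm (τ - 1) s'.1
        obtain h | h : (s.2 : ℕ) = s'.1 ∨ (s'.2 : ℕ) = s.1 := by omega
        · rw [Fin.ext h] at a3; omega
        · rw [Fin.ext h] at b3; omega
    · intro s hs x z h1 h2 hxz
      rw [Fin.le_def] at h1 h2
      apply eq_perm
      have a := hperm (τ - 1) z
      by_cases hc : 0 < r τ ∧ (s.1 : ℕ) + r τ = n ∧ (s.2 : ℕ) + 1 = n + r τ
      · have b := step τ (perm (τ - 1) z)
        unfold CentralStep at b
        omega
      · obtain ⟨a1, a2, a3, -⟩ := single τ s hs hc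
        have e1 := hperm (τ - 1) s.1
        obtain ⟨h, h'⟩ | ⟨h, h'⟩ : ((x : ℕ) = s.1 ∧ (z : ℕ) = s.2) ∨
            ((x : ℕ) = s.2 ∧ (z : ℕ) = s.1) := by omega
        · rw [Fin.ext h', a3, e1, h]
        · rw [Fin.ext h', a2, e1]; omega
    · intro x hx
      apply eq_perm
      have a := hperm (τ - 1) x
      have b := step τ (perm (τ - 1) x)
      have o1 := odd τ (perm (τ - 1) x)
      have hcen : 0 < r τ → (x : ℕ) + r τ < n ∨ n + r τ ≤ x := by
        intro h0
        have := hx (⟨n - r τ, by omega⟩, ⟨n + r τ - 1, by omega⟩)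
          ((mem_sw _ _).2 (Or.inr ⟨h0, by simp only; omega, by simp only; omega⟩))
        rw [Finset.mem_Icc, Fin.le_def, Fin.le_def] at this
        simp only at this
        omega
      have hup : y τ (perm (τ - 1) x) ≠ y (τ - 1) (perm (τ - 1) x) + 2 := by
        intro e
        have hp := hposy (τ - 1) (perm (τ - 1) x)
        rcases up_mem τ _ e with h | ⟨s, hs, h1, h2⟩
        · omega
        · have := hx s hs
          rw [Finset.mem_Icc, Fin.le_def, Fin.le_def] at this
          omega
      -- If the point moved down, the point below it would move up, and their switch would contain
      -- `x`.
      have hdown : y τ (perm (τ - 1) x) ≠ y (τ - 1) (perm (τ - 1) x) - 2 := by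
        intro e
        obtain ⟨q, hq⟩ := surj (τ - 1) (y (τ - 1) (perm (τ - 1) x) - 2) (by omega)
          (by have := lower τ (perm (τ - 1) x); omega) (by omega)
        have hd := down τ _ q e hq
        have hp := hposy (τ - 1) q
        rcases up_mem τ q (by omega) with h | ⟨s, hs, h1, h2⟩
        · omega
        · have := hx s hs
          rw [Finset.mem_Icc, Fin.le_def, Fin.le_def] at this
          omega
      unfold CentralStep at b
      omega
  refine ⟨⟨perm, sw, 2 * n, by omega, ?_, move, ?_⟩, rfl, ?_, ?_, ?_⟩
  · intro i x
    refine eq_perm _ _ _ ?_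
    push_cast
    rw [antiperiodic, hperm, Fin.val_rev]
    omega
  · intro j p q hpq
    refine (existsUnique_congr fun i => and_congr_right fun _ => ?_).1 (once j p q hpq)
    rw [(move i).together_iff hpq, hsymm, hsymm, hsymm, hsymm, Flips, ← hposy, ← hposy, ← hposy,
      ← hposy, Fin.lt_def, Fin.lt_def, Fin.lt_def, Fin.lt_def]
    omega
  · intro τ s hs hc
    rcases (mem_sw τ s).1 hs with h | h
    · exact h.1
    · exact absurd (by unfold IsCentered; omega) hc
  · intro τ p
    rw [← hposy]
    unfold coord
    push_cast
    rw [← hsymm]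
  · intro τ
    change ∑ s ∈ (sw τ).filter IsCentered, ((s.2 : ℕ) + 1 - (s.1 : ℕ)) / 2 = r τ
    have hr := radius_le τ
    rcases Nat.eq_zero_or_pos (r τ) with h0 | h0
    · rw [Finset.filter_false_of_mem, Finset.sum_empty, h0]
      intro s hs
      rcases (mem_sw τ s).1 hs with h | h
      · exact h.2.1
      · omega
    · have : (sw τ).filter IsCentered = {(⟨n - r τ, by omega⟩, ⟨n + r τ - 1, by omega⟩)} := by
        ext s
        rw [Finset.mem_filter, mem_sw, Finset.mem_singleton, Prod.ext_iff, Fin.ext_iff, Fin.ext_iff]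
        unfold IsCentered
        simp only
        omega
      rw [this, Finset.sum_singleton]
      simp only
      omega

end AllowableSequence

/-! ### The sequence of a block partition. -/

/-- A partition of the integers, invariant under translation by `n`, into intervals
`[S c, S c + D c)` shorter than `n`. -/
structure IsBlockPartition (n : ℕ) (S D : ℤ → ℤ) : Prop where
  left_le : ∀ c, S c ≤ c
  lt_right : ∀ c, c < S c + D c
  eq_of_mem : ∀ c c', S c ≤ c' → c' < S c + D c → S c' = S c ∧ D c' = D c
  left_add : ∀ c, S (c + n) = S c + n
  length_add : ∀ c, D (c + n) = D c
  length_lt : ∀ c, D c < n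

namespace IsBlockPartition

/-- The time of the crossing switch of the block of `c`. -/
def cross (S D : ℤ → ℤ) (c : ℤ) : ℤ := 2 * S c + D c

/-- The place of the point `c` at the time `τ` in the halfperiod following `cross S D c`. -/
def height (n : ℕ) (S D : ℤ → ℤ) (c τ : ℤ) : ℤ :=
  place n (D c) (S c + D c - c) (τ - cross S D c)

/-- The signed coordinate of the point `c` at the time `τ`. -/
def coord (n : ℕ) (S D : ℤ → ℤ) (c τ : ℤ) : ℤ :=
  if (τ - cross S D c) / (2 * n) % 2 = 0
  then 2 * place n (D c) (S c + D c - c) ((τ - cross S D c) % (2 * n)) - 1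
  else -(2 * place n (D c) (S c + D c - c) ((τ - cross S D c) % (2 * n)) - 1)

/-- Half the size of the crossing switch at the time `τ`. -/
def radius (S D : ℤ → ℤ) (τ : ℤ) : ℕ :=
  if τ = cross S D (τ / 2) then (D (τ / 2)).toNat else 0

variable {n : ℕ} {S D : ℤ → ℤ}

theorem length_pos (h : IsBlockPartition n S D) (c : ℤ) : 0 < D c := by
  have := h.left_le c; have := h.lt_right c; omega

theorem size_pos (h : IsBlockPartition n S D) : 1 < n := by
  have := h.length_pos 0; have := h.length_lt 0; omega

theorem cross_add (h : IsBlockPartition n S D) (c : ℤ) : cross S D (c + n) = cross S D c + 2 * n := by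
  unfold cross; rw [h.left_add, h.length_add]; ring

theorem trichotomy (h : IsBlockPartition n S D) (c c' : ℤ) :
    (S c = S c' ∧ D c = D c') ∨ S c + D c ≤ S c' ∨ S c' + D c' ≤ S c := by
  have a := h.left_le c; have b := h.lt_right c
  have a' := h.left_le c'; have b' := h.lt_right c'
  have h1 := h.eq_of_mem c (S c')
  have h2 := h.eq_of_mem c' (S c')
  have h3 := h.eq_of_mem c (S c)
  have h4 := h.eq_of_mem c' (S c)
  omega

/-- The crossing switches of blocks that meet within a halfperiod are sufficiently far apart. -/
theorem cross_sub (h : IsBlockPartition n S D) {c c' : ℤ} (h1 : cross S D c ≤ cross S D c')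
    (h2 : cross S D c' < cross S D c + 2 * n) :
    (S c = S c' ∧ D c = D c') ∨ (S c + D c ≤ S c' ∧ S c' + D c' ≤ S c + n) := by
  have a := h.trichotomy c c'
  have b := h.trichotomy (c + n) c'
  rw [h.left_add, h.length_add] at b
  have d := h.length_pos c
  have d' := h.length_pos c'
  unfold cross at *
  omega

theorem coord_add_time (h : IsBlockPartition n S D) (c τ : ℤ) :
    coord n S D c (τ + 2 * n) = -coord n S D c τ := by
  have hn := h.size_pos
  unfold coord
  rw [show τ + 2 * (n : ℤ) - cross S D c = τ - cross S D c + 2 * n by ring,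
    Int.add_emod_right, show (τ - cross S D c + 2 * (n : ℤ)) / (2 * n) =
      (τ - cross S D c) / (2 * n) + 1 from by
        rw [Int.add_ediv_of_dvd_right (dvd_refl _), Int.ediv_self (by omega)]]
  split_ifs <;> omega

/-- Translating a block by `n` delays its crossing by exactly one halfperiod, which makes `c + n`
the conjugate of `c`. -/
theorem coord_add (h : IsBlockPartition n S D) (c τ : ℤ) :
    coord n S D (c + n) τ = -coord n S D c τ := by
  rw [eq_neg_iff_add_eq_zero, ← neg_eq_iff_add_eq_zero, ← h.coord_add_time]
  unfold coord
  rw [h.cross_add, h.length_add, h.left_add, add_sub_add_right_eq_sub]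
  rw [show S c + (n : ℤ) + D c - (c + n) = S c + D c - c by ring]

theorem coord_add_even (h : IsBlockPartition n S D) (c k τ : ℤ) :
    coord n S D (c + k * (2 * n)) τ = coord n S D c τ := by
  have : Function.Periodic (fun c => coord n S D c τ) (2 * n : ℤ) :=
    Function.Antiperiodic.periodic_two_mul (f := fun c => coord n S D c τ)
      (fun c => h.coord_add c τ)
  exact this.int_mul k c

theorem cross_add_mul (h : IsBlockPartition n S D) (c k : ℤ) :
    cross S D (c + k * n) = cross S D c + 2 * (k * n) := by
  induction k with
  | zero => simp
  | succ k ih => rw [add_mul, one_mul, ← add_assoc, h.cross_add, ih]; ring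
  | pred k ih =>
    have := h.cross_add (c + (-(k : ℤ) - 1) * n)
    rw [show c + (-(k : ℤ) - 1) * n + n = c + -k * n by ring, ih] at this
    linarith

theorem coord_eq_height {c τ : ℤ} (h1 : cross S D c ≤ τ)
    (h2 : τ < cross S D c + 2 * n) : coord n S D c τ = 2 * height n S D c τ - 1 := by
  unfold coord height
  rw [Int.ediv_eq_zero_of_lt (by omega) (by omega), if_pos (Int.zero_emod 2),
    Int.emod_eq_of_lt (by omega) (by omega)]

/-- Up to conjugation, a given time lies in the halfperiod after the crossing of a given point. -/
theorem exists_phase (h : IsBlockPartition n S D) (c τ : ℤ) :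
    ∃ c' : ℤ, cross S D c' ≤ τ ∧ τ < cross S D c' + 2 * n ∧
      ((∃ k : ℤ, c' = c + k * (2 * n)) ∧ (∀ σ, coord n S D c σ = coord n S D c' σ) ∨
       (∃ k : ℤ, c' = c + k * (2 * n) + n) ∧ (∀ σ, coord n S D c σ = -coord n S D c' σ)) := by
  have hn := h.size_pos
  have e := Int.emod_add_mul_ediv (τ - cross S D c) (2 * n)
  have h0 := Int.emod_nonneg (τ - cross S D c) (b := 2 * n) (by omega)
  have h1 := Int.emod_lt_of_pos (τ - cross S D c) (b := 2 * n) (by omega)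
  set q := (τ - cross S D c) / (2 * n) with hq
  have hc := h.cross_add_mul c q
  refine ⟨c + q * n, by rw [hc]; linarith, by rw [hc]; linarith, ?_⟩
  rcases Int.even_or_odd' q with ⟨k, hk | hk⟩
  · have : c + q * n = c + k * (2 * n) := by rw [hk]; ring
    exact Or.inl ⟨⟨k, this⟩, fun σ => by rw [this, h.coord_add_even]⟩
  · have : c + q * n = c + k * (2 * n) + n := by rw [hk]; ring
    exact Or.inr ⟨⟨k, this⟩, fun σ => by rw [this, h.coord_add, h.coord_add_even, neg_neg]⟩

theorem height_bounds (h : IsBlockPartition n S D) {c τ : ℤ} :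
    1 ≤ height n S D c τ ∧ height n S D c τ ≤ n := by
  have a := h.left_le c; have b := h.lt_right c; have e := h.length_lt c
  unfold height place cross
  omega

/-- A climbing point is at place `τ - 2 * c`, which determines `c`, while a descending point is at a
place of the opposite parity; so climbing and descending points pass each other between two words.
The other cases rest on the spacing in `cross_sub`. -/
theorem height_injective (h : IsBlockPartition n S D) {c c' τ : ℤ} (h1 : cross S D c ≤ cross S D c')
    (h2 : cross S D c' ≤ τ) (h3 : τ < cross S D c + 2 * n)
    (he : height n S D c τ = height n S D c' τ) : c = c' := by
  have a := h.left_le c; have b := h.lt_right c; have e := h.length_lt c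
  have a' := h.left_le c'; have b' := h.lt_right c'; have e' := h.length_lt c'
  have d := h.cross_sub h1 (by omega)
  unfold height place cross at *
  omega

theorem height_lt_of_lt {c c' τ : ℤ} (hS : S c = S c') (hD : D c = D c')
    (hc : c < c') : height n S D c' τ < height n S D c τ := by
  unfold height place cross
  rw [hS, hD]
  omega

theorem height_step (c τ : ℤ) :
    height n S D c τ ≤ height n S D c (τ - 1) + 1 ∧ height n S D c (τ - 1) ≤ height n S D c τ + 1 := by
  unfold height place cross
  omega

theorem height_cross (h : IsBlockPartition n S D) (c : ℤ) :
    height n S D c (cross S D c) = S c + D c - c := by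
  have a := h.left_le c; have b := h.lt_right c; have e := h.length_lt c
  unfold height place
  omega

theorem height_before_cross (h : IsBlockPartition n S D) (c : ℤ) :
    height n S D c (cross S D c + 2 * n - 1) = S c + D c - c := by
  have a := h.left_le c; have b := h.lt_right c; have e := h.length_lt c
  unfold height place
  omega

/-- The points of other blocks are outside the substring reversed by a crossing switch. -/
theorem length_lt_height (h : IsBlockPartition n S D) {c c' : ℤ} (h1 : cross S D c < cross S D c')
    (h2 : cross S D c' < cross S D c + 2 * n) : D c' < height n S D c (cross S D c' - 1) ∧
      D c' < height n S D c (cross S D c') := by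
  have a := h.left_le c; have b := h.lt_right c
  have d := h.cross_sub h1.le h2
  have e' := h.length_pos c'
  unfold height place cross at *
  omega

/-- Once a point is above a point that crossed the center earlier, it stays above it. -/
theorem height_lt_succ (h : IsBlockPartition n S D) {c c' τ : ℤ} (h1 : cross S D c < cross S D c')
    (h2 : cross S D c' ≤ τ) (h3 : τ + 1 < cross S D c + 2 * n)
    (hlt : height n S D c τ < height n S D c' τ) :
    height n S D c (τ + 1) < height n S D c' (τ + 1) := by
  have a := h.left_le c; have b := h.lt_right c; have e := h.length_lt c
  have a' := h.left_le c'; have b' := h.lt_right c'; have e' := h.length_lt c'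
  have d := h.cross_sub h1.le (by omega)
  unfold height place cross at *
  omega

theorem radius_cross (h : IsBlockPartition n S D) (c : ℤ) :
    (radius S D (cross S D c) : ℤ) = D c := by
  have a := h.length_pos c
  have b := h.eq_of_mem c (cross S D c / 2) (by unfold cross; omega) (by unfold cross; omega)
  unfold radius
  rw [b.2, if_pos]
  · omega
  · change cross S D c = 2 * S (cross S D c / 2) + D (cross S D c / 2)
    rw [b.1, b.2]; rfl

theorem radius_eq (h : IsBlockPartition n S D) (τ : ℤ) :
    radius S D τ = 0 ∨ ∃ c, τ = cross S D c ∧ (radius S D τ : ℤ) = D c := by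
  by_cases hτ : τ = cross S D (τ / 2)
  · right
    refine ⟨τ / 2, hτ, ?_⟩
    conv_lhs => rw [hτ]
    exact h.radius_cross _
  · left; exact if_neg hτ

theorem centralStep (h : IsBlockPartition n S D) (c τ : ℤ) :
    CentralStep (radius S D τ) (coord n S D c (τ - 1)) (coord n S D c τ) := by
  obtain ⟨c', h1, h2, hc⟩ := h.exists_phase c (τ - 1)
  suffices hs : CentralStep (radius S D τ) (coord n S D c' (τ - 1)) (coord n S D c' τ) by
    rcases hc with ⟨-, hc⟩ | ⟨-, hc⟩
    · rw [hc, hc]; exact hs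
    · rw [hc, hc]; exact hs.neg
  rw [coord_eq_height h1 h2]
  rcases lt_or_ge τ (cross S D c' + 2 * n) with h3 | h3
  · rw [coord_eq_height (by omega) h3]
    have a := height_step (n := n) (S := S) (D := D) c' τ
    have b := h.height_bounds (c := c') (τ := τ)
    have b' := h.height_bounds (c := c') (τ := τ - 1)
    have : (radius S D τ : ℤ) < height n S D c' (τ - 1) ∧ (radius S D τ : ℤ) < height n S D c' τ := by
      rcases h.radius_eq τ with h0 | ⟨c'', rfl, h0⟩
      · rw [h0]; omega
      · rw [h0]; exact h.length_lt_height (by omega) (by omega)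
    unfold CentralStep
    omega
  · obtain rfl : τ = cross S D c' + 2 * n := by omega
    rw [h.coord_add_time, coord_eq_height le_rfl (by omega), h.height_before_cross,
      h.height_cross, ← h.cross_add, h.radius_cross, h.length_add]
    have a := h.left_le c'; have b := h.lt_right c'
    unfold CentralStep
    omega

theorem coord_injective (h : IsBlockPartition n S D) {c c' τ : ℤ}
    (he : coord n S D c τ = coord n S D c' τ) : ∃ k : ℤ, c' = c + k * (2 * n) := by
  obtain ⟨e, h1, h2, he1⟩ := h.exists_phase c τ
  obtain ⟨e', h1', h2', he1'⟩ := h.exists_phase c' τ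
  have a := coord_eq_height h1 h2
  have a' := coord_eq_height h1' h2'
  have b := h.height_bounds (c := e) (τ := τ)
  have b' := h.height_bounds (c := e') (τ := τ)
  have inj : height n S D e τ = height n S D e' τ → e = e' := fun hh => by
    rcases le_total (cross S D e) (cross S D e') with hle | hle
    · exact h.height_injective hle h1' h2 hh
    · exact (h.height_injective hle h1 h2' hh.symm).symm
  rcases he1 with ⟨⟨k, hk⟩, hc⟩ | ⟨⟨k, hk⟩, hc⟩ <;> rcases he1' with ⟨⟨k', hk'⟩, hc'⟩ | ⟨⟨k', hk'⟩, hc'⟩ <;>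
    rw [hc, hc', a, a'] at he
  · exact ⟨k - k', by rw [sub_mul]; have := inj (by omega); omega⟩
  · omega
  · omega
  · exact ⟨k - k', by rw [sub_mul]; have := inj (by omega); omega⟩

/-- Between crossing switches, some point moves up. -/
theorem exists_up (h : IsBlockPartition n S D) {τ : ℤ} (h0 : radius S D τ = 0) :
    ∃ c, coord n S D c τ = coord n S D c (τ - 1) + 2 := by
  have hl := h.left_le (τ / 2)
  have hr := h.lt_right (τ / 2)
  have hD := h.length_lt (τ / 2)
  have hne : τ ≠ cross S D (τ / 2) := fun e => by
    have := h.radius_cross (τ / 2)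
    rw [← e] at this
    have := h.length_pos (τ / 2)
    omega
  generalize hs : S (τ / 2) = s at *
  generalize hd : D (τ / 2) = d at *
  have hT : cross S D (τ / 2) = 2 * s + d := by unfold cross; rw [hs, hd]
  rcases lt_or_gt_of_ne hne with hlt | hlt
  -- Before the crossing of the block, take the point that reaches its waiting place at this move:
  -- it approaches the center from below. It has somewhere to come from because `d < n`.
  · obtain ⟨e1, e2⟩ := h.eq_of_mem (τ / 2) (s + (2 * s + d - 1 - τ)) (by omega) (by omega)
    refine ⟨s + (2 * s + d - 1 - τ), ?_⟩
    have hc : cross S D (s + (2 * s + d - 1 - τ)) = 2 * s + d := by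
      unfold cross; rw [e1, e2, hs, hd]
    have hc' := h.coord_add_time (s + (2 * s + d - 1 - τ)) τ
    have hc'' := h.coord_add_time (s + (2 * s + d - 1 - τ)) (τ - 1)
    rw [coord_eq_height (by omega) (by omega)] at hc' hc''
    unfold height place at hc' hc''
    rw [hc, e1, e2, hs, hd] at hc' hc''
    omega
  -- After the crossing, take the point that leaves its waiting place at this move.
  · obtain ⟨e1, e2⟩ := h.eq_of_mem (τ / 2) (s + (τ - (2 * s + d)) - 1) (by omega) (by omega)
    refine ⟨s + (τ - (2 * s + d)) - 1, ?_⟩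
    have hc : cross S D (s + (τ - (2 * s + d)) - 1) = 2 * s + d := by
      unfold cross; rw [e1, e2, hs, hd]
    rw [coord_eq_height (by omega) (by omega), coord_eq_height (by omega) (by omega)]
    unfold height place
    rw [hc, e1, e2, hs, hd]
    omega

/-- Two points whose order is reversed at the time `σ` and at no other time of a halfperiod. -/
theorem existsUnique_flip_of_window (h : IsBlockPartition n S D) {c c' a σ : ℤ} (h1 : a < σ)
    (h2 : σ ≤ a + 2 * n) (h3 : ∀ τ, a ≤ τ → τ < σ → coord n S D c' τ < coord n S D c τ)
    (h4 : ∀ τ, σ ≤ τ → τ < a + 2 * n → coord n S D c τ < coord n S D c' τ) (j : ℤ) :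
    ∃! i, i ∈ Set.Ioc j (j + 2 * n) ∧
      Flips (fun c => coord n S D c (i - 1)) (fun c => coord n S D c i) c c' := by
  have hn := h.size_pos
  obtain ⟨F, hF⟩ : ∃ F : ℤ → Prop, ∀ i, F i ↔
    Flips (fun c => coord n S D c (i - 1)) (fun c => coord n S D c i) c c' := ⟨_, fun _ => Iff.rfl⟩
  have hper : Function.Periodic F (2 * n : ℤ) := fun i => by
    rw [eq_iff_iff, hF, hF]
    unfold Flips
    simp only [show i + 2 * (n : ℤ) - 1 = i - 1 + 2 * n by ring, h.coord_add_time]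
    omega
  have hwin : ∀ i, a < i → i ≤ a + 2 * n → (F i ↔ i = σ) := by
    intro i hi hi'
    rw [hF]
    unfold Flips
    have hend : coord n S D c (a + 2 * n) < coord n S D c' (a + 2 * n) := by
      rw [h.coord_add_time, h.coord_add_time]
      have := h3 a le_rfl h1
      omega
    have h4' : ∀ τ, σ ≤ τ → τ ≤ a + 2 * n → coord n S D c τ < coord n S D c' τ := fun τ q q' => by
      rcases q'.lt_or_eq with q' | rfl
      · exact h4 τ q q'
      · exact hend
    rcases lt_trichotomy i σ with hlt | rfl | hlt
    · have p := h3 (i - 1) (by omega) (by omega)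
      have q := h3 i (by omega) (by omega)
      simp only
      omega
    · have p := h3 (i - 1) (by omega) (by omega)
      have q := h4' i le_rfl hi'
      simp only [iff_true]
      omega
    · have p := h4' (i - 1) (by omega) (by omega)
      have q := h4' i (by omega) (by omega)
      simp only
      omega
  -- The window is one full period, so the flips form one residue class, which meets every half-open
  -- window of that length once.
  have hmod : ∀ i, F i ↔ (2 * n : ℤ) ∣ i - σ := by
    intro i
    have e := Int.emod_add_mul_ediv (i - a - 1) (2 * n)
    have e0 := Int.emod_nonneg (i - a - 1) (b := 2 * n) (by omega)
    have e1 := Int.emod_lt_of_pos (i - a - 1) (b := 2 * n) (by omega)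
    have b := hper.sub_int_mul_eq (x := i) ((i - a - 1) / (2 * n))
    rw [mul_comm, Int.cast_id] at b
    rw [← eq_iff_iff.1 b, hwin _ (by linarith) (by linarith)]
    constructor
    · intro q
      exact ⟨(i - a - 1) / (2 * n), by linarith⟩
    · rintro ⟨k, hk⟩
      have hk' : (2 * n : ℤ) ∣ i - 2 * n * ((i - a - 1) / (2 * n)) - σ :=
        ⟨k - (i - a - 1) / (2 * n), by rw [mul_sub]; linarith⟩
      have := Int.eq_zero_of_abs_lt_dvd hk' (by rw [abs_lt]; constructor <;> linarith)
      linarith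
  simp only [← hF, hmod]
  have e := Int.emod_add_mul_ediv (σ - j - 1) (2 * n)
  have e0 := Int.emod_nonneg (σ - j - 1) (b := 2 * n) (by omega)
  have e1 := Int.emod_lt_of_pos (σ - j - 1) (b := 2 * n) (by omega)
  refine ⟨j + 1 + (σ - j - 1) % (2 * n), ⟨⟨by omega, by omega⟩,
    ⟨-((σ - j - 1) / (2 * n)), by rw [mul_neg]; linarith⟩⟩, ?_⟩
  rintro i ⟨⟨hi, hi'⟩, k, hk⟩
  have hk' : (2 * n : ℤ) ∣ i - (j + 1 + (σ - j - 1) % (2 * n)) :=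
    ⟨k + (σ - j - 1) / (2 * n), by rw [mul_add]; linarith⟩
  have := Int.eq_zero_of_abs_lt_dvd hk' (by rw [abs_lt]; constructor <;> linarith)
  linarith

theorem existsUnique_flip_of_le (h : IsBlockPartition n S D) {c c' : ℤ} (hne : c ≠ c')
    (h1 : cross S D c ≤ cross S D c') (h2 : cross S D c' < cross S D c + 2 * n) (j : ℤ) :
    ∃! i, i ∈ Set.Ioc j (j + 2 * n) ∧
      Flips (fun c => coord n S D c (i - 1)) (fun c => coord n S D c i) c c' := by
  have hn := h.size_pos
  have same : ∀ c c', c < c' → S c = S c' → D c = D c' →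
      ∃! i, i ∈ Set.Ioc j (j + 2 * n) ∧
        Flips (fun c => coord n S D c (i - 1)) (fun c => coord n S D c i) c c' := by
    intro c c' hlt hS hD
    have hT : cross S D c = cross S D c' := by unfold cross; rw [hS, hD]
    refine h.existsUnique_flip_of_window (a := cross S D c) (σ := cross S D c + 2 * n)
      (by omega) le_rfl (fun τ q q' => ?_) (fun τ q q' => by omega) j
    rw [coord_eq_height q q', coord_eq_height (by omega) (by omega)]
    have := height_lt_of_lt (n := n) hS hD hlt (τ := τ)
    omega
  have flips_comm : ∀ f g : ℤ → ℤ, ∀ c c', Flips f g c c' ↔ Flips f g c' c := fun f g c c' => by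
    unfold Flips; exact Or.comm
  rcases h.cross_sub h1 h2 with ⟨hS, hD⟩ | hdiff
  · rcases lt_or_gt_of_ne hne with hlt | hlt
    · exact same c c' hlt hS hD
    · simp only [flips_comm _ _ c c']
      exact same c' c hlt hS.symm hD.symm
  have hD := h.length_pos c
  have hD' := h.length_pos c'
  have hlt : cross S D c < cross S D c' := by unfold cross; omega
  -- By then `c` has crossed into the lower half, while `c'` is still in the upper half.
  have late : ∀ τ, cross S D c + 2 * n ≤ τ → τ < cross S D c' + 2 * n →
      coord n S D c τ < coord n S D c' τ := by
    intro τ q q'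
    rw [coord_eq_height (c := c') (by omega) q']
    have := h.coord_add_time c (τ - 2 * n)
    rw [sub_add_cancel, coord_eq_height (c := c) (τ := τ - 2 * n) (by omega) (by omega)] at this
    have := h.height_bounds (c := c) (τ := τ - 2 * n)
    have := h.height_bounds (c := c') (τ := τ)
    omega
  have hex : ∃ s : ℕ, coord n S D c (cross S D c' + s) < coord n S D c' (cross S D c' + s) :=
    ⟨(cross S D c + 2 * n - cross S D c').toNat, late _ (by omega) (by omega)⟩
  classical
  have hfle : cross S D c' + (Nat.find hex : ℤ) ≤ cross S D c + 2 * n := by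
    have := Nat.find_min' hex (m := (cross S D c + 2 * n - cross S D c').toNat)
      (late _ (by omega) (by omega))
    omega
  -- When `c'` crosses, `c` lies above the whole reversed substring. The first time at which `c'` is
  -- above `c` is the flip, and `height_lt_succ` excludes a second one.
  have hf0 : 0 < Nat.find hex := by
    rw [Nat.find_pos]
    push_cast
    rw [add_zero, coord_eq_height h1 h2, coord_eq_height le_rfl (by omega), h.height_cross]
    have := (h.length_lt_height hlt h2).2
    have := h.left_le c'
    omega
  refine h.existsUnique_flip_of_window (a := cross S D c') (σ := cross S D c' + Nat.find hex)
    (by omega) (by omega) ?_ ?_ j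
  · intro τ q q'
    have := Nat.find_min hex (m := (τ - cross S D c').toNat) (by omega)
    rw [show cross S D c' + ((τ - cross S D c').toNat : ℤ) = τ by omega] at this
    have ne : coord n S D c τ ≠ coord n S D c' τ := by
      rw [coord_eq_height (by omega) (by omega), coord_eq_height (by omega) (by omega)]
      intro e
      exact hne (h.height_injective h1 q (by omega) (by omega))
    omega
  · intro τ q q'
    obtain ⟨s, rfl⟩ : ∃ s : ℕ, τ = cross S D c' + Nat.find hex + s :=
      ⟨(τ - (cross S D c' + Nat.find hex)).toNat, by omega⟩
    rcases lt_or_ge (cross S D c' + (Nat.find hex : ℤ) + s) (cross S D c + 2 * n) with hs | hs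
    · clear q q'
      induction s with
      | zero => simpa using Nat.find_spec hex
      | succ s ih =>
        push_cast at hs ⊢
        have a := ih (by omega)
        rw [coord_eq_height (by omega) (by omega), coord_eq_height (by omega) (by omega)] at a
        rw [coord_eq_height (by omega) (by omega), coord_eq_height (by omega) (by omega),
          ← add_assoc]
        have := h.height_lt_succ hlt (τ := cross S D c' + Nat.find hex + s) (by omega) (by omega)
          (by omega)
        omega
    · exact late _ hs q'

/-- Replacing `c'` by `c' + k * (2 * n)` keeps its coordinates and moves its nominal crossing by `k
* (4 * n)`, so the two crossings may be taken at most a halfperiod apart. -/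
theorem existsUnique_flip (h : IsBlockPartition n S D) {c c' : ℤ}
    (hne : ∀ k : ℤ, c' ≠ c + k * (2 * n)) (j : ℤ) :
    ∃! i, i ∈ Set.Ioc j (j + 2 * n) ∧
      Flips (fun c => coord n S D c (i - 1)) (fun c => coord n S D c i) c c' := by
  have hn := h.size_pos
  obtain ⟨k, hk1, hk2⟩ : ∃ k : ℤ, cross S D c - 2 * n ≤ cross S D c' + k * (4 * n) ∧
      cross S D c' + k * (4 * n) < cross S D c + 2 * n := by
    refine ⟨-((cross S D c' - cross S D c + 2 * n) / (4 * n)), ?_⟩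
    have e := Int.emod_add_mul_ediv (cross S D c' - cross S D c + 2 * n) (4 * n)
    have e0 := Int.emod_nonneg (cross S D c' - cross S D c + 2 * n) (b := 4 * n) (by omega)
    have e1 := Int.emod_lt_of_pos (cross S D c' - cross S D c + 2 * n) (b := 4 * n) (by omega)
    constructor <;> linarith
  obtain ⟨e, he⟩ : ∃ e, e = c' + k * (2 * n) := ⟨_, rfl⟩
  have hce : cross S D e = cross S D c' + k * (4 * n) := by
    rw [he, show c' + k * (2 * (n : ℤ)) = c' + (2 * k) * n by ring, h.cross_add_mul]; ring
  have hco : ∀ τ, coord n S D c' τ = coord n S D e τ := fun τ => by rw [he, h.coord_add_even]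
  have hne' : c ≠ e := fun hh => hne (-k) (by rw [hh, he]; ring)
  have hflip : ∀ i, Flips (fun c => coord n S D c (i - 1)) (fun c => coord n S D c i) c c' ↔
      Flips (fun c => coord n S D c (i - 1)) (fun c => coord n S D c i) c e := fun i => by
    unfold Flips; simp only [hco]
  simp only [hflip]
  rw [← hce] at hk1 hk2
  rcases le_or_gt (cross S D c) (cross S D e) with hle | hlt
  · exact h.existsUnique_flip_of_le hne' hle hk2 j
  rcases hk1.eq_or_lt with heq | hlt'
  -- Here `e + n` crosses together with `c`, so `c` and `e` are on opposite sides for the whole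
  -- halfperiod.
  · refine h.existsUnique_flip_of_window (a := cross S D c) (σ := cross S D c + 2 * n)
      (by omega) le_rfl (fun τ q q' => ?_) (fun τ q q' => by omega) j
    have a := h.coord_add e τ
    rw [coord_eq_height (c := e + n) (by rw [h.cross_add]; omega) (by rw [h.cross_add]; omega)] at a
    rw [coord_eq_height q q']
    have := h.height_bounds (c := c) (τ := τ)
    have := h.height_bounds (c := e + n) (τ := τ)
    omega
  · have := h.existsUnique_flip_of_le hne'.symm hlt.le (by omega) j
    simpa only [Flips, or_comm] using this

/-- The allowable sequence of a block partition. -/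
theorem exists_allowableSequence (h : IsBlockPartition n S D) :
    ∃ A : AllowableSequence (2 * n), A.halfLength = 2 * n ∧ A.IsCentrallySymmetric ∧
      A.IsInNoncentralGeneralPosition ∧ ∀ τ, A.crossingSize τ = radius S D τ := by
  have hn := h.size_pos
  have bounds : ∀ c τ, -(2 * n : ℤ) < coord n S D c τ ∧ coord n S D c τ < 2 * n ∧
      coord n S D c τ % 2 = 1 := by
    intro c τ
    obtain ⟨e, h1, h2, he⟩ := h.exists_phase c τ
    have a := coord_eq_height h1 h2
    have b := h.height_bounds (c := e) (τ := τ)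
    rcases he with ⟨-, he⟩ | ⟨-, he⟩ <;> rw [he, a] <;> omega
  have rep : ∀ c : ℤ, ∃ p : Fin (2 * n), ∀ τ, coord n S D (p : ℕ) τ = coord n S D c τ := by
    intro c
    have e := Int.emod_add_mul_ediv c (2 * n)
    have e0 := Int.emod_nonneg c (b := 2 * n) (by omega)
    have e1 := Int.emod_lt_of_pos c (b := 2 * n) (by omega)
    refine ⟨⟨(c % (2 * n)).toNat, by omega⟩, fun τ => ?_⟩
    rw [← h.coord_add_even _ (c / (2 * n))]
    congr 1
    simp only
    rw [Int.toNat_of_nonneg e0]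
    linarith
  have ne : ∀ p q : Fin (2 * n), p ≠ q → ∀ k : ℤ, ((q : ℕ) : ℤ) ≠ (p : ℕ) + k * (2 * n) := by
    intro p q hpq k hk
    have hk' : (2 * n : ℤ) ∣ ((q : ℕ) : ℤ) - (p : ℕ) := ⟨k, by rw [hk]; ring⟩
    have := Int.eq_zero_of_abs_lt_dvd hk' (by rw [abs_lt]; constructor <;> omega)
    exact hpq (Fin.ext (by omega))
  obtain ⟨A, h1, h2, h3, h4⟩ := AllowableSequence.exists_of_coord (n := n)
    (y := fun τ p => coord n S D (p : ℕ) τ) (r := radius S D) (by omega)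
    (fun τ p q e => by
      by_contra hpq
      obtain ⟨k, hk⟩ := h.coord_injective e
      exact ne p q hpq k hk)
    (fun τ p => (bounds _ _).2.2) (fun τ p => (bounds _ _).1) (fun τ p => (bounds _ _).2.1)
    (fun τ => by
      rcases h.radius_eq τ with h0 | ⟨c, -, h0⟩
      · omega
      · have := h.length_lt c; omega)
    (fun τ p => h.coord_add_time _ _) (fun τ p => h.centralStep _ _)
    (fun τ h0 => by
      obtain ⟨c, hc⟩ := h.exists_up h0
      obtain ⟨p, hp⟩ := rep c
      exact ⟨p, by rw [hp, hp, hc]⟩)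
    (fun j p q hpq => h.existsUnique_flip (ne p q hpq) j)
  refine ⟨A, h1, fun p => ?_, h2, h4⟩
  obtain ⟨q, hq⟩ := rep ((p : ℕ) + n)
  refine ⟨q, fun i => ?_⟩
  have a := h3 i p
  have b := h3 i q
  rw [hq, h.coord_add, ← a] at b
  unfold AllowableSequence.coord at b
  push_cast at b
  omega

end IsBlockPartition

/-! ### Block partitions with prescribed lengths. -/

/-- The left end of the block containing `c`, where the blocks of the lengths `l` follow each other
from `0` on. -/
def blockStart : List ℕ → ℕ → ℕ
  | [], c => c
  | a :: l, c => if c < a then 0 else a + blockStart l (c - a)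

/-- The length of the block containing `c`. -/
def blockLength : List ℕ → ℕ → ℕ
  | [], _ => 1
  | a :: l, c => if c < a then a else blockLength l (c - a)

theorem blockStart_le (l : List ℕ) (c : ℕ) : blockStart l c ≤ c := by
  induction l generalizing c with
  | nil => exact le_rfl
  | cons a l ih =>
    have := ih (c - a)
    unfold blockStart
    split_ifs <;> omega

theorem lt_blockStart_add (l : List ℕ) (c : ℕ) : c < blockStart l c + blockLength l c := by
  induction l generalizing c with
  | nil => exact Nat.lt_succ_self c
  | cons a l ih =>
    have := ih (c - a)
    unfold blockStart blockLength
    split_ifs <;> omega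

theorem block_eq_of_mem (l : List ℕ) {c c' : ℕ} (h1 : blockStart l c ≤ c')
    (h2 : c' < blockStart l c + blockLength l c) :
    blockStart l c' = blockStart l c ∧ blockLength l c' = blockLength l c := by
  induction l generalizing c c' with
  | nil => unfold blockStart blockLength at *; omega
  | cons a l ih =>
    have := @ih (c - a) (c' - a)
    simp only [blockStart, blockLength] at h1 h2 ⊢
    split_ifs at * <;> omega

theorem blockStart_add_le (l : List ℕ) {c : ℕ} (hc : c < l.sum) :
    blockStart l c + blockLength l c ≤ l.sum := by
  induction l generalizing c with
  | nil => simp at hc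
  | cons a l ih =>
    have := @ih (c - a)
    rw [List.sum_cons] at *
    unfold blockStart blockLength
    split_ifs <;> omega

theorem length_le_sum_of_pos {l : List ℕ} (hl : ∀ x ∈ l, 0 < x) : l.length ≤ l.sum := by
  simpa using List.card_nsmul_le_sum l 1 hl

/-- Every other block takes up at least one integer. For two or more blocks this makes each block
shorter than the period. -/
theorem blockLength_add_length_le {l : List ℕ} (hl : ∀ x ∈ l, 0 < x) {c : ℕ} (hc : c < l.sum) :
    blockLength l c + l.length ≤ l.sum + 1 := by
  induction l generalizing c with
  | nil => simp at hc
  | cons a l ih =>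
    rw [List.forall_mem_cons] at hl
    have := @ih hl.2 (c - a)
    have := length_le_sum_of_pos hl.2
    rw [List.sum_cons, List.length_cons] at *
    unfold blockLength
    split_ifs <;> omega

/-- The length of the block whose center is at half the distance of `k` from `0`, if any. -/
def blockRadius (l : List ℕ) (k : ℕ) : ℕ :=
  if k = 2 * blockStart l (k / 2) + blockLength l (k / 2) then blockLength l (k / 2) else 0

/-- The first block accounts for the first `2 * a` values, of which only the middle one, at `a`, is
nonzero; the values after these are those of the remaining list. -/
theorem filter_blockRadius {l : List ℕ} (hl : ∀ x ∈ l, 0 < x) :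
    ((List.range (2 * l.sum)).map (blockRadius l)).filter (fun d => 0 < d) = l := by
  induction l with
  | nil => simp
  | cons a l ih =>
    rw [List.forall_mem_cons] at hl
    have e1 : ∀ k < 2 * a, blockRadius (a :: l) k = if k = a then a else 0 := by
      intro k hk
      have : k / 2 < a := by omega
      simp [blockRadius, blockStart, blockLength, this]
    have e2 : ∀ k, blockRadius (a :: l) (2 * a + k) = blockRadius l k := by
      intro k
      have h1 : (2 * a + k) / 2 = a + k / 2 := by omega
      unfold blockRadius
      rw [h1]
      simp only [blockStart, blockLength, Nat.not_lt.2 (Nat.le_add_right a (k / 2)), if_false,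
        Nat.add_sub_cancel_left]
      congr 1
      rw [eq_iff_iff]
      omega
    have h2 : 2 * (a :: l).sum = a + (1 + (a - 1)) + 2 * l.sum := by
      rw [List.sum_cons]; omega
    rw [h2, List.range_add, List.range_add, List.range_add]
    simp only [List.map_append, List.filter_append, List.map_map, List.range_one, List.map_cons,
      List.map_nil]
    have z1 : ((List.range a).map (blockRadius (a :: l))).filter (fun d => 0 < d) = [] := by
      rw [List.filter_eq_nil_iff]
      intro x hx
      obtain ⟨k, hk, rfl⟩ := List.mem_map.1 hx
      rw [List.mem_range] at hk
      rw [e1 k (by omega), if_neg (by omega)]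
      simp
    have z2 : ((List.range (a - 1)).map (blockRadius (a :: l) ∘ (fun x => a + x) ∘ fun x => 1 + x)).filter
        (fun d => 0 < d) = [] := by
      rw [List.filter_eq_nil_iff]
      intro x hx
      obtain ⟨k, hk, rfl⟩ := List.mem_map.1 hx
      rw [List.mem_range] at hk
      rw [decide_eq_true_eq, Function.comp_apply, Function.comp_apply, e1 _ (by omega),
        if_neg (by omega)]
      exact lt_irrefl 0
    have z3 : (List.range (2 * l.sum)).map (blockRadius (a :: l) ∘ fun x => a + (1 + (a - 1)) + x) =
        (List.range (2 * l.sum)).map (blockRadius l) := by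
      refine List.map_congr_left fun k _ => ?_
      rw [Function.comp_apply, ← e2]
      congr 1
      omega
    rw [z1, z2, z3, ih hl.2, Nat.add_zero, e1 a (by omega), if_pos rfl,
      List.filter_cons_of_pos (by simpa using hl.1)]
    simp

theorem isBlockPartition_of_list {d : List ℕ} (hlen : 1 < d.length) (hpos : ∀ x ∈ d, 0 < x) :
    IsBlockPartition d.sum
      (fun c => d.sum * (c / d.sum) + blockStart d (c % d.sum).toNat)
      (fun c => blockLength d (c % d.sum).toNat) := by
  have hn := length_le_sum_of_pos hpos
  have he : ∀ c : ℤ, c % d.sum + d.sum * (c / d.sum) = c := fun c => Int.emod_add_mul_ediv _ _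
  have h0 : ∀ c : ℤ, 0 ≤ c % d.sum := fun c => Int.emod_nonneg _ (by omega)
  have h1 : ∀ c : ℤ, c % d.sum < d.sum := fun c => Int.emod_lt_of_pos _ (by omega)
  constructor
  · intro c
    have := blockStart_le d (c % d.sum).toNat
    have := he c; have := h0 c
    omega
  · intro c
    have := lt_blockStart_add d (c % d.sum).toNat
    have := he c; have := h0 c
    omega
  · intro c c' ha hb
    have a := he c; have a0 := h0 c; have a1 := h1 c
    have b := blockStart_add_le d (c := (c % d.sum).toNat) (by omega)
    have e : c' = (c' - d.sum * (c / d.sum)) + d.sum * (c / d.sum) := by ring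
    have e1 : c' / d.sum = c / d.sum := by
      rw [e, Int.add_mul_ediv_left _ _ (by omega), Int.ediv_eq_zero_of_lt (by omega) (by omega)]
      simp
    have e2 := he c'
    rw [e1] at e2
    have := block_eq_of_mem d (c := (c % d.sum).toNat) (c' := (c' % d.sum).toNat) (by omega) (by omega)
    rw [e1, this.1, this.2]
    exact ⟨rfl, rfl⟩
  · intro c
    rw [Int.add_emod_right, Int.add_ediv_of_dvd_right (dvd_refl _), Int.ediv_self (by omega)]
    ring
  · intro c
    rw [Int.add_emod_right]
  · intro c
    have a0 := h0 c; have a1 := h1 c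
    have := blockLength_add_length_le hpos (c := (c % d.sum).toNat) (by omega)
    omega

theorem signature_radius_of_list {d : List ℕ} (hlen : 1 < d.length) (hpos : ∀ x ∈ d, 0 < x) :
    IsPeriodicTiling.signature d.sum (IsBlockPartition.radius
      (fun c => d.sum * (c / d.sum) + blockStart d (c % d.sum).toNat)
      (fun c => blockLength d (c % d.sum).toNat)) = d := by
  have hn := length_le_sum_of_pos hpos
  have hle := blockLength_add_length_le hpos (c := 0) (by omega)
  have hs := blockStart_le d 0
  have hl := lt_blockStart_add d 0
  set ρ := IsBlockPartition.radius
      (fun c => d.sum * (c / d.sum) + blockStart d (c % d.sum).toNat)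
      (fun c => blockLength d (c % d.sum).toNat) with hρ
  have e1 : ∀ k < 2 * d.sum, ρ (k : ℕ) = blockRadius d k := by
    intro k hk
    have hk2 : (k : ℤ) / 2 = (k / 2 : ℕ) := by omega
    have hm : ((k : ℤ) / 2) % d.sum = (k / 2 : ℕ) := by
      rw [hk2]; exact Int.emod_eq_of_lt (by omega) (by omega)
    have hq : ((k : ℤ) / 2) / d.sum = 0 := by
      rw [hk2]; exact Int.ediv_eq_zero_of_lt (by omega) (by omega)
    simp only [hρ, IsBlockPartition.radius, IsBlockPartition.cross, hm, hq, blockRadius,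
      Int.toNat_natCast, mul_zero, zero_add]
    congr 1
    rw [eq_iff_iff]
    omega
  -- The signature reads times `1, …, 2 * n`, the list above `0, …, 2 * n - 1`. The two ends do not
  -- matter: `0` and `n` are left ends of nonempty blocks, so there is no crossing at time `0` or `2
  -- * n`.
  have e0 : blockRadius d 0 = 0 := if_neg (by simp only [Nat.zero_div]; omega)
  have e2 : ρ ((2 * d.sum : ℕ) : ℤ) = 0 := by
    have hk2 : ((2 * d.sum : ℕ) : ℤ) / 2 = d.sum := by omega
    refine if_neg ?_
    unfold IsBlockPartition.cross
    rw [hk2]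
    beta_reduce
    rw [Int.emod_self, Int.ediv_self (by omega), Int.toNat_zero]
    omega
  have a : ((List.range (2 * d.sum + 1)).map fun k : ℕ => ρ k).filter (fun d => 0 < d) =
      IsPeriodicTiling.signature d.sum ρ := by
    rw [List.range_succ_eq_map, List.map_cons, Nat.cast_zero, List.map_map,
      List.filter_cons_of_neg (by have := e1 0 (by omega); rw [Nat.cast_zero] at this; simp [this, e0])]
    rfl
  rw [← a, List.range_succ, List.map_append, List.filter_append, List.map_congr_left (fun k hk =>
    e1 k (List.mem_range.1 hk)), filter_blockRadius hpos, List.map_singleton, e2]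
  simp

/-! ### Uniqueness and conclusion. -/

namespace AllowableSequence

/-- Uniqueness: the central signature determines the sequence. -/
theorem combinatoriallyEquivalent_of_isRotated {n : ℕ} {A A' : AllowableSequence (2 * n)}
    (h : A.halfLength = 2 * n) (h' : A'.halfLength = 2 * n)
    (hc : A.IsCentrallySymmetric) (hc' : A'.IsCentrallySymmetric)
    (hg : A.IsInNoncentralGeneralPosition) (hg' : A'.IsInNoncentralGeneralPosition)
    (hlen : 1 < A.centralSignature.length)
    (hrot : List.IsRotated A'.centralSignature A.centralSignature) :
    A.CombinatoriallyEquivalent A' := by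
  have t := A.isTrajectory h hc hg
  have t' := A'.isTrajectory h' hc' hg'
  rw [A.centralSignature_eq h, A'.centralSignature_eq h'] at hrot
  rw [A.centralSignature_eq h] at hlen
  obtain ⟨k₁, hk₁⟩ := t'.isPeriodicTiling.exists_shift_signature hrot
  obtain ⟨k₂, hk₂⟩ := t.isPeriodicTiling.eq_of_signature_eq (t'.isPeriodicTiling.shift k₁) hk₁.symm hlen
  have t'' := t'.shift (k₂ + k₁)
  have hr : (fun τ => A'.crossingSize (τ + (k₂ + k₁))) = A.crossingSize := funext fun τ => by
    rw [← hk₂, add_assoc]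
  rw [hr] at t''
  -- The relabeling matches the words at times `0` and `k₂ + k₁`; the point given by `exists_eq`
  -- agrees in position at time `0`, hence is the relabeled one.
  refine ⟨(A.perm 0).symm.trans (A'.perm (k₂ + k₁)), k₂ + k₁, fun i x y hxy => ?_⟩
  obtain rfl : x = y := Fin.ext hxy
  obtain ⟨q, hq⟩ := t.exists_eq t'' (A.perm i x)
  have q0 := hq 0
  have qi := hq i
  simp only [coord, Equiv.symm_apply_apply, zero_add] at q0 qi
  rw [Equiv.trans_apply, ← (Equiv.symm_apply_eq _).1 (Fin.ext (by omega) :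
    (A'.perm (k₂ + k₁)).symm q = (A.perm 0).symm (A.perm i x))]
  exact ((Equiv.symm_apply_eq _).1 (Fin.ext (by omega))).symm

end AllowableSequence

theorem theorem3p4 (d : List ℕ) (hlen : 1 < d.length) (hpos : ∀ x ∈ d, 0 < x) :
    ∃ (m : ℕ) (A : AllowableSequence m),
      (A.IsEvenNearCritical ∧ A.IsCentrallySymmetric ∧ A.IsInNoncentralGeneralPosition ∧
        A.centralSignature = d) ∧
      ∀ (m' : ℕ) (A' : AllowableSequence m'),
        A'.IsEvenNearCritical → A'.IsCentrallySymmetric → A'.IsInNoncentralGeneralPosition →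
          List.IsRotated A'.centralSignature d → A.CombinatoriallyEquivalent A' := by
  obtain ⟨A, h1, h2, h3, h4⟩ := (isBlockPartition_of_list hlen hpos).exists_allowableSequence
  have hsig : A.centralSignature = d := by
    rw [A.centralSignature_eq h1, funext h4]
    exact signature_radius_of_list hlen hpos
  refine ⟨2 * d.sum, A, ⟨⟨even_two_mul _, by omega⟩, h2, h3, hsig⟩, ?_⟩
  rintro m' A' ⟨hm, h1'⟩ h2' h3' hrot
  obtain ⟨n, rfl⟩ : ∃ n, m' = 2 * n := hm.two_dvd
  have h1'' : A'.halfLength = 2 * n := by omega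
  -- The signature of any such sequence sums to half the number of points, and rotation preserves
  -- the sum.
  have hn : n = d.sum := by
    rw [← hrot.perm.sum_eq, A'.centralSignature_eq h1'',
      (A'.isTrajectory h1'' h2' h3').isPeriodicTiling.sum_signature]
  subst hn
  exact AllowableSequence.combinatoriallyEquivalent_of_isRotated h1 h1'' h2 h2' h3 h3' (by rwa [hsig])
    (by rwa [hsig])
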